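/- **Theorem 1.4 (polar dual of a free Hilbert spectrahedrop).** Let $\mathscr H,\mathscr K$ be separable real Hilbert spaces, let $\Omega_1,\dots,\Omega_g,\Gamma_1,\dots,\Gamma_h$ be bounded self-adjoint operators on $\mathscr H$, and let $$L(x,y)=I_{\mathscr H}+\sum_{j=1}^g\Omega_jx_j+\sum_{k=1}^h\Gamma_ky_k$$ be the corresponding monic linear pencil. *Notation.* Write $\mathbb S_K$ for the set of bounded self-adjoint operators on a Hilbert space $K$. For a tuple $B$ of self-adjoint operators on a Hilbert space $E$ and a tuple $X$ of the same length in $\mathbb S_{K}$, put $L_B(X)=I_E\otimes I_{K}+\sum_i B_i\otimes X_i$ (so $L=L_{(\Omega,\Gamma)}$). Let $D_L^{\mathscr K}$ be the family $(D_L(K))_K$, indexed by the closed subspaces $K\subseteq\mathscr K$, with $D_L(K)=\{(X,Y)\in\mathbb S_K^{g+h}: L(X,Y)\succeq0\}$, and let $\mathcal K=\operatorname{proj}_xD_L^{\mathscr K}$ be the family $\mathcal K(K)=\{X\in\mathbb S_K^g:\exists\,Y\in\mathbb S_K^h,\ L(X,Y)\succeq0\}$. The operator free Hilbert polar dual of a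 family $\mathcal S=(\mathcal S(K))_K$ of sets of $m$-tuples is the family $\mathcal S^{\mathscr K,\circ}$ with $$\mathcal S^{\circ}(K)=\{A\in\mathbb S_K^m: L_A(X)\succeq0\text{ for every closed subspace }K'\subseteq\mathscr K\text{ and every }X\in\mathcal S(K')\}.$$ Finally, $\operatorname{proj}_xD_L(1)=\{x\in\mathbb R^g:\exists\,y\in\mathbb R^h,\ L(x,y)\succeq0\}$. A $*$-homomorphism is not required to be unital. *Claim.* For every closed subspace $K\subseteq\mathscr K$ (in particular for $K=\mathscr K$): 1. $$\begin{aligned}\mathcal K^{\circ}(K)&=\{A\in\mathbb S_K^g:(A,0)\in (D_L^{\mathscr K})^{\circ}(K)\}\\&=\{A\in\mathbb S_K^g:\ \exists\,\mathscr G,\ V,\ \pi\text{ with }A_j=V^*\pi(\Omega_j\oplus0)V\ (1\le j\le g),\ 0=V^*\pi(\Gamma_k\oplus0)V\ (1\le k\le h)\},\end{aligned}$$ where $\mathscr G$ is a real Hilbert space, separable if $\mathscr H$ is finite-dimensional, $V:K\to\mathscr G$ is an isometry, and $\pi:B(\mathscr H\oplus\mathbb R)\to B(\mathscr G)$ is a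 $*$-homomorphism. 2. If $\operatorname{proj}_xD_L(1)$ is bounded, then also $$\mathcal K^{\circ}(K)=\{A\in\mathbb S_K^g:\ \exists\,\mathscr G,\ V,\ \pi\text{ with }A_j=V^*\pi(\Omega_j)V\ (1\le j\le g),\ 0=V^*\pi(\Gamma_k)V\ (1\le k\le h)\},$$ where $\mathscr G$ is a real Hilbert space, separable if $\mathscr H$ is finite-dimensional, $V:K\to\mathscr G$ is an isometry, and $\pi:B(\mathscr H)\to B(\mathscr G)$ is a $*$-homomorphism. -/

import Mathlib

open scoped TensorProduct

universe u v

noncomputable section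

namespace FreeHilbert

/-- A closed subspace of a Hilbert space is complete. -/
instance {𝒦 : Type*} [NormedAddCommGroup 𝒦] [InnerProductSpace ℝ 𝒦] [CompleteSpace 𝒦]
    (K : ClosedSubmodule ℝ 𝒦) : CompleteSpace K.toSubmodule :=
  K.isClosed.completeSpace_coe

/-- A family `(S K)_K`, indexed by the lattice of closed subspaces `K` of `𝒦`, of sets `S K` of
`ι`-tuples of bounded operators on `K`. -/
abbrev OperatorSet (ι : Type*) (𝒦 : Type*) [NormedAddCommGroup 𝒦] [InnerProductSpace ℝ 𝒦] :=
  (K : ClosedSubmodule ℝ 𝒦) → Set (ι → (K.toSubmodule →L[ℝ] K.toSubmodule))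

section Pencil

variable {ι : Type*} [Fintype ι] {E F : Type*}
  [NormedAddCommGroup E] [InnerProductSpace ℝ E] [NormedAddCommGroup F] [InnerProductSpace ℝ F]

/-- The value `L_A(X) = I ⊗ I + ∑ i, A i ⊗ X i` of the monic linear pencil `L_A` at the tuple `X`.
It is a bounded operator on the tensor product `E ⊗ F` with its Hilbertian inner product, a dense
subspace of the Hilbert space tensor product. Since `⟪T v, v⟫ ≥ 0` is a closed condition on `v`,
the bounded extension of `L_A(X)` to the completion is positive semidefinite if and only if
`L_A(X)` is. -/
def monicPencil (A : ι → E →L[ℝ] E) (X : ι → F →L[ℝ] F) : (E ⊗[ℝ] F) →L[ℝ] (E ⊗[ℝ] F) :=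
  TensorProduct.mapL (1 : E →L[ℝ] E) (1 : F →L[ℝ] F) + ∑ i, TensorProduct.mapL (A i) (X i)

end Pencil

section Sets

variable {ι κ : Type*} [Fintype ι] [Fintype κ]
  {H : Type*} [NormedAddCommGroup H] [InnerProductSpace ℝ H]
  (𝒦 : Type*) [NormedAddCommGroup 𝒦] [InnerProductSpace ℝ 𝒦] [CompleteSpace 𝒦]

/-- The operator free Hilbert spectrahedron `D_{L_A}^𝒦`: its `K`-th component is the set of tuples
`X` of self-adjoint operators on `K` with `L_A(X) ⪰ 0`. -/
def spectrahedron (A : ι → H →L[ℝ] H) : OperatorSet ι 𝒦 := fun _ =>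
  {X | (∀ i, IsSelfAdjoint (X i)) ∧ (monicPencil A X).IsPositive}

variable {𝒦}

/-- The projection `proj_x D` of a family of sets of tuples `(X, Y)` on the variables `X`,
componentwise: `Y` lives on the same closed subspace as `X`. -/
def projX (D : OperatorSet (ι ⊕ κ) 𝒦) : OperatorSet ι 𝒦 := fun K =>
  {X | ∃ Y : κ → (K.toSubmodule →L[ℝ] K.toSubmodule), Sum.elim X Y ∈ D K}

/-- The operator free Hilbert polar dual of the family `S`: its `K`-th component is the set of
tuples `A` of self-adjoint operators on `K` such that `L_A(X) ⪰ 0` for all `X` in `S`, on whatever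
closed subspace `K'` of `𝒦` the tuple `X` lives. -/
def polarDual (S : OperatorSet ι 𝒦) : OperatorSet ι 𝒦 := fun _ =>
  {A | (∀ i, IsSelfAdjoint (A i)) ∧
    ∀ K' : ClosedSubmodule ℝ 𝒦, ∀ X ∈ S K', (monicPencil A X).IsPositive}

/-- The Hilbert spectrahedral shadow `proj_x D_L(1)` of the monic pencil
`L(x, y) = I + ∑ j, Ω j x_j + ∑ k, Γ k y_k`, a subset of `ℝ^ι`. -/
def shadow (Ω : ι → H →L[ℝ] H) (Γ : κ → H →L[ℝ] H) : Set (EuclideanSpace ℝ ι) :=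
  {x | ∃ y : EuclideanSpace ℝ κ,
    ((1 : H →L[ℝ] H) + ∑ j, x j • Ω j + ∑ k, y k • Γ k).IsPositive}

end Sets

/-- The operator `T ⊕ 0` on the Hilbert space direct sum `H ⊕ ℝ`. -/
def oplusZero {H : Type*} [NormedAddCommGroup H] [InnerProductSpace ℝ H] (T : H →L[ℝ] H) :
    WithLp 2 (H × ℝ) →L[ℝ] WithLp 2 (H × ℝ) :=
  (WithLp.prodContinuousLinearEquiv 2 ℝ H ℝ).symm.toContinuousLinearMap ∘L
    (T.prodMap (0 : ℝ →L[ℝ] ℝ)) ∘L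
      (WithLp.prodContinuousLinearEquiv 2 ℝ H ℝ).toContinuousLinearMap

/-- The set of tuples `A` of self-adjoint operators on `F` for which there are a real Hilbert space
`G`, separable if `E` is finite-dimensional, an isometry `V : F → G` and a (not necessarily unital)
`*`-homomorphism `π : B(E) → B(G)` with `A = V* π(Ω) V` and `0 = V* π(Γ) V`. -/
def compressions {ι κ : Type*} {E : Type u} [NormedAddCommGroup E] [InnerProductSpace ℝ E]
    [CompleteSpace E] (Ω : ι → E →L[ℝ] E) (Γ : κ → E →L[ℝ] E)
    (F : Type v) [NormedAddCommGroup F] [InnerProductSpace ℝ F] [CompleteSpace F] :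
    Set (ι → F →L[ℝ] F) :=
  {A | (∀ j, IsSelfAdjoint (A j)) ∧
    ∃ (G : Type (max u v)) (_ : NormedAddCommGroup G) (_ : InnerProductSpace ℝ G)
      (_ : CompleteSpace G),
      (FiniteDimensional ℝ E → TopologicalSpace.SeparableSpace G) ∧
      ∃ (V : F →ₗᵢ[ℝ] G) (π : (E →L[ℝ] E) →⋆ₙₐ[ℝ] (G →L[ℝ] G)),
        (∀ j, A j = ContinuousLinearMap.adjoint V.toContinuousLinearMap ∘L π (Ω j) ∘L
          V.toContinuousLinearMap) ∧
        (∀ k, 0 = ContinuousLinearMap.adjoint V.toContinuousLinearMap ∘L π (Γ k) ∘L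
          V.toContinuousLinearMap)}

end FreeHilbert

end

/-! A tuple `A` lies in the polar dual of the projection exactly when positivity of `L(X, Y)` forces
positivity of the pencil with coefficients `(A, 0)`: the zero coefficients make that pencil blind to
`Y` (`polarDual_projX`). What remains is a Positivstellensatz: this implication holds exactly when
`(A, 0)` is a compression of a represented coefficient tuple.

Compressions belong to the polar dual because `*`-homomorphisms are completely positive
(`sum_inner_map_nonneg`). Since `π` may be non-unital, the projection `1 - π 1` leaves an extra term
in the constant part of the pencil, but that term is a sum of products of Gram entries and hence
nonnegative (`isPositive_monicPencil_compression`).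

Conversely, testing on finite-dimensional subspaces of `𝒦` turns membership into an implication
between quadratic forms with real matrix coefficients (`matrixForm_nonneg_of_mem_polarDual`). A
congruence replaces the constant term `I` by an arbitrary matrix `C` (`matrixForm_nonneg_of_monic`),
provided that `c + ∑ y_l B_l ⪰ 0` forces `c ≥ 0`. For the coefficients `B ⊕ 0` the added coordinate
guarantees this; for `B` itself boundedness of the shadow does, as soon as there is an `x` variable
(`nonneg_of_isBounded_shadow`).

The homogeneous implication says that sending the function `u ↦ ⟪B_l (u k), u k'⟫` of a linear map
`u : K → E` to `⟪A_l k, k'⟫`, with `1` going to `1`, is a positive linear assignment. M. Riesz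
extension makes it a positive functional on all dominated functions (`exists_positiveFunctional`),
and a GNS construction yields `G`, `V` and `π` (`exists_isometry_starHom`). This does the work of
Arveson extension and Stinespring dilation in one stroke. -/

noncomputable section

namespace FreeHilbert

/-! ### Positivity of `*`-homomorphisms over the reals -/

section StarHom

variable {E G : Type*} [NormedAddCommGroup E] [InnerProductSpace ℝ E] [CompleteSpace E]
  [NormedAddCommGroup G] [InnerProductSpace ℝ G]

/-- For a positive operator `R`, the norm of `R x` is controlled by the quadratic form of `R`. -/
theorem norm_sq_apply_le_of_isPositive {R : G →L[ℝ] G} (hR : R.IsPositive) (x : G) :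
    ‖R x‖ ^ 2 ≤ (‖R‖ + 1) * inner ℝ (R x) x := by
  have hpos : 0 < ‖R‖ + 1 := by positivity
  -- The inequality comes from evaluating the form of `R` at `x - t • R x`. The `+ 1` keeps `t`
  -- meaningful when `R = 0`.
  set t : ℝ := (‖R‖ + 1)⁻¹ with ht
  have h1 : 0 ≤ inner ℝ (R (x - t • R x)) (x - t • R x) := hR.inner_nonneg_left _
  have h2 : inner ℝ (R (R x)) x = ‖R x‖ ^ 2 := by
    rw [hR.inner_left_eq_inner_right, real_inner_self_eq_norm_sq]
  have h3 : inner ℝ (R (R x)) (R x) ≤ ‖R‖ * ‖R x‖ ^ 2 := by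
    calc inner ℝ (R (R x)) (R x) ≤ ‖R (R x)‖ * ‖R x‖ := real_inner_le_norm _ _
      _ ≤ ‖R‖ * ‖R x‖ * ‖R x‖ := by gcongr; exact R.le_opNorm _
      _ = _ := by ring
  have h4 : inner ℝ (R (x - t • R x)) (x - t • R x) =
      inner ℝ (R x) x - 2 * t * ‖R x‖ ^ 2 + t ^ 2 * inner ℝ (R (R x)) (R x) := by
    simp only [map_sub, map_smul, inner_sub_left, inner_sub_right, inner_smul_left,
      inner_smul_right, h2, real_inner_self_eq_norm_sq, conj_trivial]
    ring
  have h5 : t * (‖R‖ + 1) = 1 := inv_mul_cancel₀ hpos.ne'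
  have h6 : t ^ 2 * inner ℝ (R (R x)) (R x) ≤ t * ‖R x‖ ^ 2 := by
    calc t ^ 2 * inner ℝ (R (R x)) (R x) ≤ t ^ 2 * ((‖R‖ + 1) * ‖R x‖ ^ 2) := by
          gcongr; nlinarith [sq_nonneg ‖R x‖]
      _ = (t * (‖R‖ + 1)) * (t * ‖R x‖ ^ 2) := by ring
      _ = _ := by rw [h5, one_mul]
  have h7 : t * ‖R x‖ ^ 2 ≤ inner ℝ (R x) x := by linarith
  calc ‖R x‖ ^ 2 = (‖R‖ + 1) * (t * ‖R x‖ ^ 2) := by rw [← mul_assoc, mul_comm _ t, h5, one_mul]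
    _ ≤ _ := by gcongr

/-- A positive operator with a left inverse is bounded below. -/
theorem exists_pos_le_inner_of_isPositive {R R' : G →L[ℝ] G} (hR : R.IsPositive)
    (h : R' * R = 1) : ∃ δ > 0, ∀ x, δ * ‖x‖ ^ 2 ≤ inner ℝ (R x) x := by
  have hpos : 0 < (‖R'‖ + 1) ^ 2 * (‖R‖ + 1) := by positivity
  refine ⟨((‖R'‖ + 1) ^ 2 * (‖R‖ + 1))⁻¹, inv_pos.2 hpos, fun x => ?_⟩
  rw [inv_mul_le_iff₀ hpos]
  have h1 : ‖x‖ ≤ (‖R'‖ + 1) * ‖R x‖ := by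
    calc ‖x‖ = ‖R' (R x)‖ := by
          rw [← mul_apply_eq_comp, h, one_apply_eq_self]
      _ ≤ ‖R'‖ * ‖R x‖ := R'.le_opNorm _
      _ ≤ _ := by gcongr; linarith
  calc ‖x‖ ^ 2 ≤ ((‖R'‖ + 1) * ‖R x‖) ^ 2 := by gcongr
    _ = (‖R'‖ + 1) ^ 2 * ‖R x‖ ^ 2 := by ring
    _ ≤ (‖R'‖ + 1) ^ 2 * ((‖R‖ + 1) * inner ℝ (R x) x) := by
        gcongr; exact norm_sq_apply_le_of_isPositive hR x
    _ = _ := by ring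

/-- The quadratic form is coercive with constant `c`, which already gives invertibility. -/
theorem isUnit_add_smul_one {T : E →L[ℝ] E} (hT : T.IsPositive) {c : ℝ} (hc : 0 < c) :
    IsUnit (T + c • (1 : E →L[ℝ] E)) := by
  refine ContinuousLinearMap.isUnit_of_forall_le_norm_inner_map _ (c := c.toNNReal)
    (Real.toNNReal_pos.2 hc)
    fun x => ?_
  refine le_trans ?_ (le_abs_self _)
  have h : inner ℝ ((T + c • (1 : E →L[ℝ] E)) x) x = inner ℝ (T x) x + c * ‖x‖ ^ 2 := by
    simp [inner_add_left, inner_smul_left]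
  rw [h, Real.coe_toNNReal c hc.le, mul_comm]
  linarith [hT.inner_nonneg_left x]

/-- A `*`-homomorphism between algebras of operators on real Hilbert spaces is positive. -/
theorem isPositive_map [CompleteSpace G] (ρ : (E →L[ℝ] E) →⋆ₙₐ[ℝ] (G →L[ℝ] G)) {T : E →L[ℝ] E}
    (hT : T.IsPositive) : (ρ T).IsPositive := by
  have hsa : IsSelfAdjoint (ρ T) := hT.isSelfAdjoint.map ρ
  -- The shifts that make `ρ T` positive. The least one is attained; if it were some `c > 0`,
  -- invertibility of `T + c` would make `ρ T + c` bounded below, and a smaller shift would do.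
  let C : Set ℝ := {c | 0 ≤ c ∧ ∀ x, 0 ≤ inner ℝ (ρ T x) x + c * ‖x‖ ^ 2}
  have hne : C.Nonempty := by
    refine ⟨‖ρ T‖, norm_nonneg _, fun x => ?_⟩
    have h1 := abs_real_inner_le_norm (ρ T x) x
    have h2 : ‖ρ T x‖ * ‖x‖ ≤ ‖ρ T‖ * ‖x‖ * ‖x‖ := by gcongr; exact (ρ T).le_opNorm x
    have h3 := neg_abs_le (inner ℝ (ρ T x) x)
    nlinarith
  have hbdd : BddBelow C := ⟨0, fun c hc => hc.1⟩
  have hclosed : IsClosed C := by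
    have : C = Set.Ici 0 ∩ ⋂ x, {c | 0 ≤ inner ℝ (ρ T x) x + c * ‖x‖ ^ 2} := by
      ext c; simp [C]
    rw [this]
    refine isClosed_Ici.inter (isClosed_iInter fun x => ?_)
    exact isClosed_le continuous_const (by fun_prop)
  have hmem : sInf C ∈ C := hclosed.csInf_mem hne hbdd
  rw [ContinuousLinearMap.isPositive_iff']
  refine ⟨hsa, ?_⟩
  rcases hmem.1.eq_or_lt with h0 | hc
  · intro x
    simpa [← h0] using hmem.2 x
  exfalso
  set c := sInf C
  obtain ⟨W, hW⟩ := (isUnit_add_smul_one hT hc).exists_left_inv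
  have hR : (ρ T + c • (1 : G →L[ℝ] G)).IsPositive := by
    rw [ContinuousLinearMap.isPositive_iff']
    refine ⟨hsa.add ((IsSelfAdjoint.all c).smul (.one _)), fun x => ?_⟩
    simpa [inner_add_left, inner_smul_left] using hmem.2 x
  -- `ρ W` inverts only up to the projection `ρ 1`. On the complement, `(1 - ρ 1) * ρ T = 0`, so the
  -- operator acts there as `c` and `c⁻¹` corrects it.
  have hinv : (ρ W + c⁻¹ • (1 - ρ 1)) * (ρ T + c • (1 : G →L[ℝ] G)) = 1 := by
    have h1 : ρ W * ρ T + c • ρ W = ρ 1 := by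
      rw [← map_mul, ← map_smul, ← map_add, ← hW, mul_add, mul_smul_comm, mul_one]
    have h2 : ρ 1 * ρ T = ρ T := by rw [← map_mul, one_mul]
    rw [add_mul, mul_add, mul_smul_comm, mul_one, h1, mul_add, smul_mul_assoc, sub_mul, h2,
      one_mul, sub_self, smul_zero, zero_add, smul_mul_smul_comm, inv_mul_cancel₀ hc.ne',
      one_smul, mul_one, add_sub_cancel]
  obtain ⟨δ, hδ, hδR⟩ := exists_pos_le_inner_of_isPositive hR hinv
  -- The minimum with `c` keeps the new shift nonnegative, as `C` demands.
  have hmin : c - min δ c ∈ C := by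
    refine ⟨by linarith [min_le_right δ c], fun x => ?_⟩
    have h1 := hδR x
    simp only [add_apply, smul_apply, one_apply_eq_self, inner_add_left, inner_smul_left,
      conj_trivial, real_inner_self_eq_norm_sq] at h1
    nlinarith [mul_le_mul_of_nonneg_right (min_le_left δ c) (sq_nonneg ‖x‖)]
  have := csInf_le hbdd hmin
  have := lt_min hδ hc
  linarith

end StarHom

/-! ### Operator matrices and complete positivity -/

section Ampliation

variable (n : Type*) [DecidableEq n]
  (E : Type*) [NormedAddCommGroup E] [InnerProductSpace ℝ E]

/-- The `i`-th coordinate inclusion of `E` into the Hilbert sum of copies of `E`. -/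
def coordIncl (i : n) : E →L[ℝ] PiLp 2 (fun _ : n => E) :=
  (PiLp.continuousLinearEquiv 2 ℝ (fun _ : n => E)).symm.toContinuousLinearMap ∘L
    ContinuousLinearMap.single ℝ (fun _ : n => E) i

/-- The `i`-th coordinate projection of the Hilbert sum of copies of `E` onto `E`. -/
def coordProj (i : n) : PiLp 2 (fun _ : n => E) →L[ℝ] E :=
  PiLp.proj 2 (fun _ : n => E) i

variable {n E}

omit [DecidableEq n] in
@[simp] theorem coordProj_apply (i : n) (x : PiLp 2 (fun _ : n => E)) :
    coordProj n E i x = x i := rfl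

theorem coordIncl_apply (i j : n) (x : E) : coordIncl n E i x j = if j = i then x else 0 := by
  simp [coordIncl]

variable [Fintype n]

theorem sum_coordIncl_apply (x : n → E) (j : n) : (∑ i, coordIncl n E i (x i)) j = x j := by
  simp [coordIncl_apply]

theorem sum_coordIncl_coordProj :
    ∑ i, coordIncl n E i ∘L coordProj n E i = 1 := by
  ext x j
  simp [coordIncl_apply]

theorem inner_coordIncl (i : n) (x : E) (y : PiLp 2 (fun _ : n => E)) :
    inner ℝ (coordIncl n E i x) y = inner ℝ x (y i) := by
  rw [PiLp.inner_apply, Finset.sum_eq_single i]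
  · simp [coordIncl_apply]
  · intro j _ hj
    simp [coordIncl_apply, hj]
  · simp

/-- The `(i, j)` block of an operator on a Hilbert sum. -/
def block (τ : PiLp 2 (fun _ : n => E) →L[ℝ] PiLp 2 (fun _ : n => E)) (i j : n) : E →L[ℝ] E :=
  coordProj n E i ∘L τ ∘L coordIncl n E j

theorem block_mul (τ σ : PiLp 2 (fun _ : n => E) →L[ℝ] PiLp 2 (fun _ : n => E)) (i j : n) :
    block (τ * σ) i j = ∑ k, block τ i k * block σ k j := by
  have h : τ * σ = τ * (∑ k, coordIncl n E k ∘L coordProj n E k) * σ := by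
    rw [sum_coordIncl_coordProj, mul_one]
  ext x
  rw [h]
  simp [block]

/-- The operator on a Hilbert sum with prescribed blocks. -/
def ofBlock (T : n → n → E →L[ℝ] E) : PiLp 2 (fun _ : n => E) →L[ℝ] PiLp 2 (fun _ : n => E) :=
  ∑ i, ∑ j, coordIncl n E i ∘L T i j ∘L coordProj n E j

theorem ofBlock_apply (T : n → n → E →L[ℝ] E) (x : PiLp 2 (fun _ : n => E)) (i : n) :
    ofBlock T x i = ∑ j, T i j (x j) := by
  simp [ofBlock, coordIncl_apply]

theorem block_ofBlock (T : n → n → E →L[ℝ] E) : block (ofBlock T) = T := by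
  ext i j x
  simp only [block, ContinuousLinearMap.comp_apply, coordProj_apply, ofBlock_apply,
    coordIncl_apply]
  simp [apply_ite]

theorem ofBlock_block (τ : PiLp 2 (fun _ : n => E) →L[ℝ] PiLp 2 (fun _ : n => E)) :
    ofBlock (block τ) = τ := by
  ext x i
  have h : x = ∑ k, coordIncl n E k (x k) := by
    ext j
    rw [sum_coordIncl_apply]
  conv_rhs => rw [h]
  simp [ofBlock_apply, block]

theorem block_injective {τ σ : PiLp 2 (fun _ : n => E) →L[ℝ] PiLp 2 (fun _ : n => E)}
    (h : ∀ i j, block τ i j = block σ i j) : τ = σ := by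
  rw [← ofBlock_block τ, ← ofBlock_block σ, funext₂ h]

variable [CompleteSpace E]

theorem adjoint_coordIncl (i : n) :
    ContinuousLinearMap.adjoint (coordIncl n E i) = coordProj n E i := by
  symm
  rw [ContinuousLinearMap.eq_adjoint_iff]
  intro x y
  exact (real_inner_comm _ _).trans ((inner_coordIncl i y x).symm.trans (real_inner_comm _ _))

theorem adjoint_block (τ : PiLp 2 (fun _ : n => E) →L[ℝ] PiLp 2 (fun _ : n => E)) (i j : n) :
    star (block τ i j) = block (star τ) j i := by
  simp only [ContinuousLinearMap.star_eq_adjoint, block, ContinuousLinearMap.adjoint_comp,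
    ← adjoint_coordIncl, ContinuousLinearMap.adjoint_adjoint]
  rfl

variable {G : Type*} [NormedAddCommGroup G] [InnerProductSpace ℝ G] [CompleteSpace G]

variable (n) in
/-- The entrywise action of a `*`-homomorphism on operator matrices. -/
def ampliation (π : (E →L[ℝ] E) →⋆ₙₐ[ℝ] (G →L[ℝ] G)) :
    (PiLp 2 (fun _ : n => E) →L[ℝ] PiLp 2 (fun _ : n => E)) →⋆ₙₐ[ℝ]
      (PiLp 2 (fun _ : n => G) →L[ℝ] PiLp 2 (fun _ : n => G)) where
  toFun τ := ofBlock fun i j => π (block τ i j)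
  map_smul' c τ := block_injective fun i j => by
    have : ∀ σ : PiLp 2 (fun _ : n => G) →L[ℝ] PiLp 2 (fun _ : n => G),
      block (c • σ) i j = c • block σ i j := fun σ => by ext; simp [block]
    rw [MonoidHom.id_apply, this, block_ofBlock, block_ofBlock, ← map_smul]
    rfl
  map_zero' := block_injective fun i j => by
    rw [block_ofBlock]
    simp [block]
  map_add' τ σ := block_injective fun i j => by
    have : ∀ τ σ : PiLp 2 (fun _ : n => G) →L[ℝ] PiLp 2 (fun _ : n => G),
      block (τ + σ) i j = block τ i j + block σ i j := fun τ σ => by ext; simp [block]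
    rw [this, block_ofBlock, block_ofBlock, block_ofBlock, ← map_add]
    rfl
  map_mul' τ σ := block_injective fun i j => by
    simp only [block_mul, block_ofBlock, map_sum, map_mul]
  map_star' τ := block_injective fun i j => by
    rw [← adjoint_block, block_ofBlock, block_ofBlock, ← adjoint_block, map_star]

/-- A `*`-homomorphism is completely positive. -/
theorem sum_inner_map_nonneg (π : (E →L[ℝ] E) →⋆ₙₐ[ℝ] (G →L[ℝ] G)) {T : n → n → E →L[ℝ] E}
    (hsa : ∀ i j, star (T i j) = T j i)
    (hT : ∀ x : n → E, 0 ≤ ∑ i, ∑ j, inner ℝ (T i j (x j)) (x i)) (y : n → G) :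
    0 ≤ ∑ i, ∑ j, inner ℝ (π (T i j) (y j)) (y i) := by
  have hpos : (ofBlock T).IsPositive := by
    rw [ContinuousLinearMap.isPositive_iff']
    refine ⟨block_injective fun i j => ?_, fun x => ?_⟩
    · rw [← adjoint_block, block_ofBlock, hsa]
    · simpa [PiLp.inner_apply, ofBlock_apply, sum_inner] using hT x
  have h := (isPositive_map (ampliation n π) hpos).inner_nonneg_left (WithLp.toLp 2 y)
  have h2 : ampliation n π (ofBlock T) = ofBlock fun i j => π (T i j) := by
    change ofBlock (fun i j => π (block (ofBlock T) i j)) = _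
    rw [block_ofBlock]
  rw [h2] at h
  simpa [PiLp.inner_apply, ofBlock_apply, sum_inner] using h

end Ampliation

/-! ### The quadratic form of a monic pencil -/

section PencilForm

variable {ι : Type*} [Fintype ι] {E F : Type*}
  [NormedAddCommGroup E] [InnerProductSpace ℝ E] [NormedAddCommGroup F] [InnerProductSpace ℝ F]

/-- The quadratic form of `L_A(X)` on a finite sum of elementary tensors. -/
theorem inner_monicPencil_sum {n : Type*} [Fintype n] (A : ι → E →L[ℝ] E) (X : ι → F →L[ℝ] F)
    (x : n → E) (f : n → F) :
    inner ℝ (monicPencil A X (∑ i, x i ⊗ₜ[ℝ] f i)) (∑ i, x i ⊗ₜ[ℝ] f i) =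
      ∑ i, ∑ j, (inner ℝ (x i) (x j) * inner ℝ (f i) (f j) +
        ∑ l, inner ℝ (A l (x i)) (x j) * inner ℝ (X l (f i)) (f j)) := by
  rw [map_sum, sum_inner]
  refine Finset.sum_congr rfl fun i _ => ?_
  rw [inner_sum]
  refine Finset.sum_congr rfl fun j _ => ?_
  simp [monicPencil, inner_add_left, sum_inner]

theorem exists_eq_sum_tmul (v : E ⊗[ℝ] F) :
    ∃ (n : ℕ) (x : Fin n → E) (f : Fin n → F), v = ∑ i, x i ⊗ₜ[ℝ] f i := by
  obtain ⟨S, hS⟩ := TensorProduct.exists_finset v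
  refine ⟨S.card, fun i => (S.equivFin.symm i).1.1, fun i => (S.equivFin.symm i).1.2, ?_⟩
  rw [hS, ← Finset.sum_coe_sort S]
  exact (Equiv.sum_comp S.equivFin.symm fun p : S => p.1.1 ⊗ₜ[ℝ] p.1.2).symm

theorem isSymmetric_mapL {S : E →L[ℝ] E} {T : F →L[ℝ] F} (hS : S.IsSymmetric)
    (hT : T.IsSymmetric) : (TensorProduct.mapL S T).IsSymmetric := by
  intro v w
  induction v with
  | zero => simp
  | add a b ha hb => rw [map_add, inner_add_left, inner_add_left, ha, hb]
  | tmul a b =>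
    induction w with
    | zero => simp
    | add c d hc hd => rw [map_add, inner_add_right, inner_add_right, hc, hd]
    | tmul c d =>
      have h1 : inner ℝ (S a) c = inner ℝ a (S c) := hS a c
      have h2 : inner ℝ (T b) d = inner ℝ b (T d) := hT b d
      simp [h1, h2]

theorem isSymmetric_monicPencil {A : ι → E →L[ℝ] E} {X : ι → F →L[ℝ] F}
    (hA : ∀ i, (A i).IsSymmetric) (hX : ∀ i, (X i).IsSymmetric) :
    (monicPencil A X).IsSymmetric := by
  intro v w
  have h1 := isSymmetric_mapL (S := (1 : E →L[ℝ] E)) (T := (1 : F →L[ℝ] F))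
    (fun _ _ => rfl) (fun _ _ => rfl) v w
  have h2 := fun i => isSymmetric_mapL (hA i) (hX i) v w
  simp only [ContinuousLinearMap.coe_coe] at h1 h2 ⊢
  simp only [monicPencil, add_apply, sum_apply, inner_add_left, inner_add_right, sum_inner,
    inner_sum, h1, h2]

/-- Every vector of the algebraic tensor product is a finite sum of elementary tensors, so
positivity becomes scalar inequalities in which the two legs can be treated separately. -/
theorem isPositive_monicPencil_iff {A : ι → E →L[ℝ] E} {X : ι → F →L[ℝ] F}
    (hA : ∀ i, (A i).IsSymmetric) (hX : ∀ i, (X i).IsSymmetric) :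
    (monicPencil A X).IsPositive ↔ ∀ (n : ℕ) (x : Fin n → E) (f : Fin n → F),
      0 ≤ ∑ i, ∑ j, (inner ℝ (x i) (x j) * inner ℝ (f i) (f j) +
        ∑ l, inner ℝ (A l (x i)) (x j) * inner ℝ (X l (f i)) (f j)) := by
  constructor
  · intro h n x f
    rw [← inner_monicPencil_sum]
    exact h.inner_nonneg_left _
  · intro h
    refine ⟨isSymmetric_monicPencil hA hX, fun v => ?_⟩
    obtain ⟨n, x, f, rfl⟩ := exists_eq_sum_tmul v
    rw [ContinuousLinearMap.reApplyInnerSelf_apply, RCLike.re_to_real, inner_monicPencil_sum]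
    exact h n x f

/-- The Schur product of two Gram matrices is the Gram matrix of the vectors `x i ⊗ f i`, and the
sum of its entries is a squared norm. -/
theorem sum_gram_mul_gram_nonneg {n : Type*} [Fintype n] (x : n → E) (f : n → F) :
    0 ≤ ∑ i, ∑ j, inner ℝ (x i) (x j) * inner ℝ (f i) (f j) := by
  have h : inner ℝ (∑ i, x i ⊗ₜ[ℝ] f i) (∑ i, x i ⊗ₜ[ℝ] f i) =
      ∑ i, ∑ j, inner ℝ (x i) (x j) * inner ℝ (f i) (f j) := by
    simp only [sum_inner]
    refine Finset.sum_congr rfl fun i _ => ?_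
    simp [inner_sum]
  rw [← h]
  exact inner_self_nonneg (𝕜 := ℝ) (E := E ⊗[ℝ] F)

end PencilForm

/-! ### Adding a zero summand to the coefficients -/

section OplusZero

variable {H : Type*} [NormedAddCommGroup H] [InnerProductSpace ℝ H]

theorem oplusZero_apply (T : H →L[ℝ] H) (x : WithLp 2 (H × ℝ)) :
    oplusZero T x = WithLp.toLp 2 (T x.fst, 0) := rfl

theorem inner_oplusZero (T : H →L[ℝ] H) (x y : WithLp 2 (H × ℝ)) :
    inner ℝ (oplusZero T x) y = inner ℝ (T x.fst) y.fst := by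
  simp [oplusZero_apply, WithLp.prod_inner_apply]

theorem isSymmetric_oplusZero {T : H →L[ℝ] H} (hT : T.IsSymmetric) :
    (oplusZero T).IsSymmetric := fun x y =>
  (inner_oplusZero T x y).trans <| (hT _ _).trans <| (real_inner_comm _ _).trans <|
    (inner_oplusZero T y x).symm.trans (real_inner_comm _ _)

theorem isSelfAdjoint_oplusZero [CompleteSpace H] {T : H →L[ℝ] H} (hT : IsSelfAdjoint T) :
    IsSelfAdjoint (oplusZero T) := by
  rw [ContinuousLinearMap.isSelfAdjoint_iff_isSymmetric] at hT ⊢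
  exact isSymmetric_oplusZero hT

variable {ι : Type*} [Fintype ι] {F : Type*} [NormedAddCommGroup F] [InnerProductSpace ℝ F]

/-- The new pencil is the direct sum of the old one and the identity, whose form is a product of
Gram matrices. -/
theorem isPositive_monicPencil_oplusZero {A : ι → H →L[ℝ] H} {X : ι → F →L[ℝ] F}
    (hA : ∀ i, (A i).IsSymmetric) (hX : ∀ i, (X i).IsSymmetric)
    (h : (monicPencil A X).IsPositive) :
    (monicPencil (fun i => oplusZero (A i)) X).IsPositive := by
  rw [isPositive_monicPencil_iff hA hX] at h
  rw [isPositive_monicPencil_iff (fun i => isSymmetric_oplusZero (hA i)) hX]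
  intro n x f
  have h1 := h n (fun i => (x i).fst) f
  have h2 := sum_gram_mul_gram_nonneg (fun i => (x i).snd) f
  refine (add_nonneg h1 h2).trans_eq ?_
  rw [← Finset.sum_add_distrib]
  refine Finset.sum_congr rfl fun i _ => ?_
  rw [← Finset.sum_add_distrib]
  refine Finset.sum_congr rfl fun j _ => ?_
  simp only [inner_oplusZero]
  rw [WithLp.prod_inner_apply]
  simp only [WithLp.fst, WithLp.snd]
  ring

end OplusZero

/-! ### Compressions preserve positivity of the pencil -/

section Compression

variable {ι : Type*} [Fintype ι] {E F G K : Type*}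
  [NormedAddCommGroup E] [InnerProductSpace ℝ E] [CompleteSpace E]
  [NormedAddCommGroup G] [InnerProductSpace ℝ G] [CompleteSpace G]
  [NormedAddCommGroup K] [InnerProductSpace ℝ K] [CompleteSpace K]
  [NormedAddCommGroup F] [InnerProductSpace ℝ F]

/-- Positivity of `L_B(X)` passes to compressions of images of `B` under a `*`-homomorphism. -/
theorem isPositive_monicPencil_compression {B : ι → E →L[ℝ] E} {A : ι → K →L[ℝ] K}
    {X : ι → F →L[ℝ] F} (hB : ∀ i, IsSelfAdjoint (B i)) (hA : ∀ i, IsSelfAdjoint (A i))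
    (hX : ∀ i, (X i).IsSymmetric) (V : K →ₗᵢ[ℝ] G)
    (π : (E →L[ℝ] E) →⋆ₙₐ[ℝ] (G →L[ℝ] G))
    (hAB : ∀ i, A i = ContinuousLinearMap.adjoint V.toContinuousLinearMap ∘L π (B i) ∘L
      V.toContinuousLinearMap)
    (h : (monicPencil B X).IsPositive) : (monicPencil A X).IsPositive := by
  have hB' := fun i => ContinuousLinearMap.isSelfAdjoint_iff_isSymmetric.1 (hB i)
  have hA' := fun i => ContinuousLinearMap.isSelfAdjoint_iff_isSymmetric.1 (hA i)
  rw [isPositive_monicPencil_iff hB' hX] at h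
  rw [isPositive_monicPencil_iff hA' hX]
  intro n k f
  -- Pairing the second leg of `L_B(X)` with the vectors `f` leaves an operator matrix over `B(E)`,
  -- to which complete positivity of `π` applies.
  let T : Fin n → Fin n → E →L[ℝ] E := fun i j =>
    (inner ℝ (f j) (f i) : ℝ) • (1 : E →L[ℝ] E) + ∑ l, (inner ℝ (X l (f j)) (f i) : ℝ) • B l
  have hT : ∀ i j, star (T i j) = T j i := by
    intro i j
    have hX' : ∀ l, inner ℝ (X l (f j)) (f i) = inner ℝ (X l (f i)) (f j) := fun l =>
      (hX l (f j) (f i)).trans (real_inner_comm _ _)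
    simp only [T, star_add, star_sum, star_smul, star_one, (hB _).star_eq, star_trivial, hX']
    rw [real_inner_comm]
  have hpos : ∀ x : Fin n → E, 0 ≤ ∑ i, ∑ j, inner ℝ (T i j (x j)) (x i) := by
    intro x
    rw [Finset.sum_comm]
    convert h n x f using 4 with i _ j _
    simp [T, inner_add_left, sum_inner, inner_smul_left, mul_comm]
  have key := sum_inner_map_nonneg π hT hpos (fun i => V (k i))
  -- `π` turns the constant term into `π 1`, not `1`. As `1 - π 1` is a projection, the difference
  -- is a Gram matrix.
  have hP : ∀ a b : G, inner ℝ ((1 - π 1) a) ((1 - π 1) b) = inner ℝ a b - inner ℝ (π 1 a) b := by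
    intro a b
    have hsa : ContinuousLinearMap.adjoint (π 1) = π 1 := by
      rw [← ContinuousLinearMap.star_eq_adjoint, ← map_star, star_one]
    have hid : π 1 (π 1 a) = π 1 a := by
      rw [← mul_apply_eq_comp, ← map_mul, one_mul]
    have h1 : inner ℝ a (π 1 b) = inner ℝ (π 1 a) b := by
      rw [← ContinuousLinearMap.adjoint_inner_left, hsa]
    have h2 : inner ℝ (π 1 a) (π 1 b) = inner ℝ (π 1 a) b := by
      rw [← ContinuousLinearMap.adjoint_inner_left, hsa, hid]
    simp [inner_sub_left, inner_sub_right, h1, h2]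
  have hgram := sum_gram_mul_gram_nonneg (fun i => (1 - π 1) (V (k i))) f
  rw [Finset.sum_comm] at key
  refine (add_nonneg key hgram).trans_eq ?_
  simp only [hP, ← Finset.sum_add_distrib]
  refine Finset.sum_congr rfl fun i _ => Finset.sum_congr rfl fun j _ => ?_
  simp only [T, hAB, map_add, map_sum, map_smul, add_apply, sum_apply, smul_apply, inner_add_left,
    sum_inner, inner_smul_left, conj_trivial, ContinuousLinearMap.comp_apply,
    ContinuousLinearMap.adjoint_inner_left, LinearIsometry.coe_toContinuousLinearMap,
    LinearIsometry.inner_map_map]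
  have : ∀ l, inner ℝ (X l (f i)) (f j) * inner ℝ (π (B l) (V (k i))) (V (k j)) =
    inner ℝ (π (B l) (V (k i))) (V (k j)) * inner ℝ (X l (f i)) (f j) := fun l => mul_comm _ _
  simp only [this]
  ring

end Compression

/-! ### Polar dual of a projection -/

section PolarDual

variable {ι κ : Type*} [Fintype ι] [Fintype κ] {𝒦 : Type*} [NormedAddCommGroup 𝒦]
  [InnerProductSpace ℝ 𝒦] [CompleteSpace 𝒦]

theorem monicPencil_sumElim_zero {E F : Type*} [NormedAddCommGroup E] [InnerProductSpace ℝ E]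
    [NormedAddCommGroup F] [InnerProductSpace ℝ F] (A : ι → E →L[ℝ] E) (X : ι → F →L[ℝ] F)
    (Y : κ → F →L[ℝ] F) :
    monicPencil (Sum.elim A fun _ : κ => 0) (Sum.elim X Y) = monicPencil A X := by
  simp [monicPencil]

theorem polarDual_projX (D : OperatorSet (ι ⊕ κ) 𝒦) (K : ClosedSubmodule ℝ 𝒦) :
    polarDual (projX D) K =
      {A | (∀ j, IsSelfAdjoint (A j)) ∧ Sum.elim A (fun _ : κ => 0) ∈ polarDual D K} := by
  ext A
  constructor
  · rintro ⟨hA, h⟩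
    refine ⟨hA, ?_, fun K' Z hZ => ?_⟩
    · rintro (i | k)
      · exact hA i
      · exact IsSelfAdjoint.zero (K.toSubmodule →L[ℝ] K.toSubmodule)
    · have hZ' : Sum.elim (Z ∘ Sum.inl) (Z ∘ Sum.inr) = Z := Sum.elim_comp_inl_inr Z
      rw [← hZ', monicPencil_sumElim_zero]
      exact h K' _ ⟨Z ∘ Sum.inr, hZ'.symm ▸ hZ⟩
  · rintro ⟨hA, -, h⟩
    refine ⟨hA, fun K' X hX => ?_⟩
    obtain ⟨Y, hY⟩ := hX
    rw [← monicPencil_sumElim_zero A X Y]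
    exact h K' _ hY

end PolarDual

/-! ### Riesz extension -/

section Riesz

/-- The M. Riesz extension theorem for a functional given on a parametrized subspace. -/
theorem exists_nonneg_extension {D M : Type*} [AddCommGroup D] [Module ℝ D] [AddCommGroup M]
    [Module ℝ M] (s : PointedCone ℝ M) (j : D →ₗ[ℝ] M) (f : D →ₗ[ℝ] ℝ)
    (nonneg : ∀ d, j d ∈ s → 0 ≤ f d) (dense : ∀ m, ∃ d, j d + m ∈ s) :
    ∃ Λ : M →ₗ[ℝ] ℝ, (∀ d, Λ (j d) = f d) ∧ ∀ m ∈ s, 0 ≤ Λ m := by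
  -- `j` need not be injective. Both `d` and `-d` are mapped into the cone when `j d = 0`, so `f`
  -- vanishes there and descends to the range of `j`.
  have hker : LinearMap.ker j ≤ LinearMap.ker f := by
    intro d hd
    rw [LinearMap.mem_ker] at hd ⊢
    have h1 := nonneg d (by rw [hd]; exact s.zero_mem)
    have h2 := nonneg (-d) (by rw [map_neg, hd, neg_zero]; exact s.zero_mem)
    rw [map_neg] at h2
    linarith
  let p : M →ₗ.[ℝ] ℝ := ⟨LinearMap.range j,
    (LinearMap.ker j).liftQ f hker ∘ₗ j.quotKerEquivRange.symm.toLinearMap⟩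
  have hp : ∀ d, p ⟨j d, LinearMap.mem_range_self j d⟩ = f d := by
    intro d
    change (LinearMap.ker j).liftQ f hker (j.quotKerEquivRange.symm ⟨j d, _⟩) = f d
    rw [LinearMap.quotKerEquivRange_symm_apply_image]
    rfl
  have hp0 : ∀ x : p.domain, (x : M) ∈ s → 0 ≤ p x := by
    rintro ⟨_, d, rfl⟩ hd
    exact (nonneg d hd).trans_eq (hp d).symm
  have hpd : ∀ m, ∃ x : p.domain, (x : M) + m ∈ s := fun m =>
    (dense m).imp' (fun d => ⟨j d, LinearMap.mem_range_self j d⟩) fun _ hd => hd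
  obtain ⟨Λ, hΛ, hs⟩ := riesz_extension s p hp0 hpd
  exact ⟨Λ, fun d => (hΛ ⟨j d, LinearMap.mem_range_self j d⟩).trans (hp d), hs⟩

end Riesz

/-! ### The pre-Hilbert space of a positive functional -/

section GNS

variable (E : Type u) [NormedAddCommGroup E] [InnerProductSpace ℝ E]
  (K : Type v) [NormedAddCommGroup K] [InnerProductSpace ℝ K]

/-- Real functions on `K →ₗ E` dominated by finitely many of the functions `u ↦ ‖u k‖ ^ 2`. -/
def dominated : Submodule ℝ ((K →ₗ[ℝ] E) → ℝ) where
  carrier := {m | ∃ (s : Finset K) (c : ℝ), 0 ≤ c ∧ ∀ u, |m u| ≤ c * ∑ k ∈ s, ‖u k‖ ^ 2}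
  zero_mem' := ⟨∅, 0, le_rfl, fun u => by simp⟩
  add_mem' := by
    classical
    rintro m m' ⟨s, c, hc, h⟩ ⟨s', c', hc', h'⟩
    refine ⟨s ∪ s', c + c', by positivity, fun u => (abs_add_le _ _).trans ?_⟩
    rw [add_mul]
    refine add_le_add ((h u).trans ?_) ((h' u).trans ?_)
    · gcongr
      exact Finset.subset_union_left
    · gcongr
      exact Finset.subset_union_right
  smul_mem' := by
    rintro r m ⟨s, c, hc, h⟩
    refine ⟨s, |r| * c, by positivity, fun u => ?_⟩
    rw [Pi.smul_apply, smul_eq_mul, abs_mul, mul_assoc]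
    gcongr
    exact h u

/-- The span of the functions `u ↦ R (u k)` on `K →ₗ E`. -/
def evalSpan : Submodule ℝ ((K →ₗ[ℝ] E) → E) :=
  Submodule.span ℝ (Set.range fun p : (E →L[ℝ] E) × K => fun u : K →ₗ[ℝ] E => p.1 (u p.2))

variable {E K}

theorem norm_sq_mem_dominated {n : (K →ₗ[ℝ] E) → E} (hn : n ∈ evalSpan E K) :
    (fun u => ‖n u‖ ^ 2) ∈ dominated E K := by
  have mono : ∀ {m m' : (K →ₗ[ℝ] E) → ℝ}, m' ∈ dominated E K → (∀ u, 0 ≤ m u) →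
      (∀ u, m u ≤ m' u) → m ∈ dominated E K := by
    rintro m m' ⟨s, c, hc, h⟩ h0 hle
    exact ⟨s, c, hc, fun u => (abs_of_nonneg (h0 u)).trans_le
      ((hle u).trans ((le_abs_self _).trans (h u)))⟩
  induction hn using Submodule.span_induction with
  | mem x hx =>
    obtain ⟨⟨R, k⟩, rfl⟩ := hx
    refine ⟨{k}, ‖R‖ ^ 2, by positivity, fun u => ?_⟩
    rw [abs_of_nonneg (by positivity), Finset.sum_singleton, ← mul_pow]
    exact pow_le_pow_left₀ (norm_nonneg _) (R.le_opNorm _) 2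
  | zero => exact mono (dominated E K).zero_mem (fun u => by positivity) fun u => by simp
  | add a b _ _ ha hb =>
    refine mono ((dominated E K).smul_mem 2 ((dominated E K).add_mem ha hb))
      (fun u => by positivity) fun u => ?_
    have h := norm_add_le (a u) (b u)
    simp only [Pi.add_apply, Pi.smul_apply, smul_eq_mul]
    nlinarith [sq_nonneg (‖a u‖ - ‖b u‖), norm_nonneg (a u + b u)]
  | smul r a _ ha =>
    refine mono ((dominated E K).smul_mem (r ^ 2) ha) (fun u => by positivity) fun u => ?_
    simp [norm_smul, mul_pow]

/-- Polarization reduces this to squared norms. -/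
theorem inner_mem_dominated {n n' : (K →ₗ[ℝ] E) → E} (hn : n ∈ evalSpan E K)
    (hn' : n' ∈ evalSpan E K) : (fun u => inner ℝ (n u) (n' u)) ∈ dominated E K := by
  have h := (dominated E K).smul_mem (1 / 4 : ℝ) ((dominated E K).sub_mem
    (norm_sq_mem_dominated ((evalSpan E K).add_mem hn hn'))
    (norm_sq_mem_dominated ((evalSpan E K).sub_mem hn hn')))
  convert h using 2 with u
  simp only [Pi.smul_apply, Pi.sub_apply, Pi.add_apply, smul_eq_mul, norm_add_sq_real,
    norm_sub_sq_real]
  ring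

theorem clm_eval_mem_evalSpan (T : E →L[ℝ] E) (k : K) :
    (fun u : K →ₗ[ℝ] E => T (u k)) ∈ evalSpan E K :=
  Submodule.subset_span ⟨(T, k), rfl⟩

theorem clm_comp_mem_evalSpan (T : E →L[ℝ] E) {n : (K →ₗ[ℝ] E) → E} (hn : n ∈ evalSpan E K) :
    (fun u => T (n u)) ∈ evalSpan E K := by
  induction hn using Submodule.span_induction with
  | mem x hx =>
    obtain ⟨⟨R, k⟩, rfl⟩ := hx
    exact clm_eval_mem_evalSpan (T * R) k
  | zero =>
    convert (evalSpan E K).zero_mem with u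
    simp
  | add a b _ _ ha hb =>
    convert (evalSpan E K).add_mem ha hb with u
    simp
  | smul r a _ ha =>
    convert (evalSpan E K).smul_mem r ha with u
    simp

/-- The function `u ↦ ⟪T (u k), u k'⟫`, as a bilinear map in `k` and `k'`. -/
def formEval (T : E →L[ℝ] E) : K →ₗ[ℝ] K →ₗ[ℝ] dominated E K :=
  LinearMap.mk₂ ℝ (fun k k' => ⟨fun u => inner ℝ (T (u k)) (u k'),
      inner_mem_dominated (clm_eval_mem_evalSpan T k) (clm_eval_mem_evalSpan 1 k')⟩)
    (fun _ _ _ => by ext; simp [inner_add_left])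
    (fun _ _ _ => by ext; simp [inner_smul_left])
    (fun _ _ _ => by ext; simp [inner_add_right])
    (fun _ _ _ => by ext; simp [inner_smul_right])

@[simp] theorem formEval_apply (T : E →L[ℝ] E) (k k' : K) (u : K →ₗ[ℝ] E) :
    (formEval T k k' : (K →ₗ[ℝ] E) → ℝ) u = inner ℝ (T (u k)) (u k') := rfl

variable (E K) in
/-- A linear functional on the dominated functions, nonnegative on the nonnegative ones. -/
structure PositiveFunctional where
  /-- The underlying linear functional. -/
  toLinearMap : dominated E K →ₗ[ℝ] ℝ
  nonneg : ∀ m : dominated E K, (∀ u, 0 ≤ (m : (K →ₗ[ℝ] E) → ℝ) u) → 0 ≤ toLinearMap m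

/-- The pre-Hilbert space of a positive functional: the span of the functions `u ↦ R (u k)` with
the semi-inner product obtained by applying the functional to pointwise inner products. -/
def PreGNS (_ : PositiveFunctional E K) : Type (max u v) := evalSpan E K

namespace PreGNS

variable (Λ : PositiveFunctional E K)

instance : AddCommGroup (PreGNS Λ) := inferInstanceAs (AddCommGroup (evalSpan E K))

instance : Module ℝ (PreGNS Λ) := inferInstanceAs (Module ℝ (evalSpan E K))

variable {Λ}

/-- An element of the pre-Hilbert space as a function. -/
def eval : PreGNS Λ →ₗ[ℝ] ((K →ₗ[ℝ] E) → E) := (evalSpan E K).subtype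

theorem eval_mem (x : PreGNS Λ) : eval x ∈ evalSpan E K := Subtype.prop x

variable (Λ) in
/-- A function in the span, as an element of the pre-Hilbert space. -/
def mk (n : (K →ₗ[ℝ] E) → E) (hn : n ∈ evalSpan E K) : PreGNS Λ := ⟨n, hn⟩

@[simp] theorem eval_mk_apply (n : (K →ₗ[ℝ] E) → E) (hn : n ∈ evalSpan E K) (u : K →ₗ[ℝ] E) :
    eval (mk Λ n hn) u = n u := rfl

theorem eval_injective : Function.Injective (eval : PreGNS Λ → _) := Subtype.val_injective

/-- The pointwise inner product. -/
def pointwiseInner (x y : PreGNS Λ) : dominated E K :=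
  ⟨fun u => inner ℝ (eval x u) (eval y u), inner_mem_dominated x.eval_mem y.eval_mem⟩

theorem pointwiseInner_apply (x y : PreGNS Λ) (u : K →ₗ[ℝ] E) :
    (pointwiseInner x y : (K →ₗ[ℝ] E) → ℝ) u = inner ℝ (eval x u) (eval y u) := rfl

instance : PreInnerProductSpace.Core ℝ (PreGNS Λ) where
  inner x y := Λ.toLinearMap (pointwiseInner x y)
  conj_inner_symm x y := by
    rw [conj_trivial]
    congr 1
    ext u
    exact real_inner_comm _ _
  re_inner_nonneg x := Λ.nonneg _ fun u => real_inner_self_nonneg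
  add_left x y z := by
    rw [← map_add]
    congr 1
    ext u
    simp [pointwiseInner_apply, inner_add_left]
  smul_left x y r := by
    rw [conj_trivial, ← smul_eq_mul, ← map_smul]
    congr 1
    ext u
    simp [pointwiseInner_apply, inner_smul_left]

instance : SeminormedAddCommGroup (PreGNS Λ) :=
  InnerProductSpace.Core.toSeminormedAddCommGroup (𝕜 := ℝ)

instance : InnerProductSpace ℝ (PreGNS Λ) := InnerProductSpace.ofCore inferInstance

theorem inner_def (x y : PreGNS Λ) : inner ℝ x y = Λ.toLinearMap (pointwiseInner x y) := rfl

/-- Positivity of `Λ` integrates the pointwise inequality between squares. This is what makes the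
pointwise action of `B(E)` bounded. -/
theorem norm_le_of_forall {x y : PreGNS Λ} {c : ℝ} (hc : 0 ≤ c)
    (h : ∀ u, ‖eval x u‖ ≤ c * ‖eval y u‖) : ‖x‖ ≤ c * ‖y‖ := by
  refine abs_le_of_sq_le_sq' ?_ (by positivity) |>.2
  have h1 : 0 ≤ Λ.toLinearMap (c ^ 2 • pointwiseInner y y - pointwiseInner x x) := by
    refine Λ.nonneg _ fun u => ?_
    have := pow_le_pow_left₀ (norm_nonneg _) (h u) 2
    simp only [Submodule.coe_sub, Submodule.coe_smul, Pi.sub_apply, Pi.smul_apply,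
      pointwiseInner_apply, real_inner_self_eq_norm_sq, smul_eq_mul]
    linarith [mul_pow c ‖eval y u‖ 2]
  rw [map_sub, map_smul, smul_eq_mul, ← inner_def, ← inner_def, real_inner_self_eq_norm_sq,
    real_inner_self_eq_norm_sq] at h1
  linarith [mul_pow c ‖y‖ 2]

/-- Pointwise application of an operator. -/
def act (T : E →L[ℝ] E) : PreGNS Λ →L[ℝ] PreGNS Λ :=
  LinearMap.mkContinuous
    { toFun := fun x => mk Λ (fun u => T (eval x u)) (clm_comp_mem_evalSpan T x.eval_mem)
      map_add' := fun x y => eval_injective (by ext u; simp)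
      map_smul' := fun r x => eval_injective (by ext u; simp) }
    ‖T‖ fun x => norm_le_of_forall (norm_nonneg _) fun u => T.le_opNorm _

@[simp] theorem eval_act (T : E →L[ℝ] E) (x : PreGNS Λ) (u : K →ₗ[ℝ] E) :
    eval (act T x) u = T (eval x u) := rfl

theorem inner_act_left [CompleteSpace E] (T : E →L[ℝ] E) (x y : PreGNS Λ) :
    inner ℝ (act (star T) x) y = inner ℝ x (act T y) := by
  rw [inner_def, inner_def]
  congr 1
  ext u
  simp [pointwiseInner_apply, ContinuousLinearMap.star_eq_adjoint,
    ContinuousLinearMap.adjoint_inner_left]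

/-- The evaluation map `k ↦ (u ↦ u k)`. -/
def evalAt : K →ₗ[ℝ] PreGNS Λ where
  toFun k := mk Λ (fun u => u k) (clm_eval_mem_evalSpan 1 k)
  map_add' _ _ := eval_injective (by ext u; exact map_add u _ _)
  map_smul' _ _ := eval_injective (by ext u; exact map_smul u _ _)

/-- Cyclicity of the image of `K` under `B(E)`, needed for separability. -/
theorem span_act_evalAt :
    Submodule.span ℝ (Set.range fun p : (E →L[ℝ] E) × K =>
      act p.1 (evalAt p.2 : PreGNS Λ)) = ⊤ := by
  apply Submodule.map_injective_of_injective (eval_injective (Λ := Λ))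
  rw [Submodule.map_span, ← Set.range_comp, Submodule.map_top]
  exact ((evalSpan E K).range_subtype).symm

theorem norm_evalAt (h1 : ∀ k k', Λ.toLinearMap (formEval 1 k k') = inner ℝ k k') (k : K) :
    ‖(evalAt k : PreGNS Λ)‖ = ‖k‖ := by
  have h : ‖(evalAt k : PreGNS Λ)‖ ^ 2 = ‖k‖ ^ 2 := by
    rw [← real_inner_self_eq_norm_sq, ← real_inner_self_eq_norm_sq, ← h1]
    rfl
  exact (sq_eq_sq₀ (norm_nonneg _) (norm_nonneg _)).1 h

theorem norm_act_le (T : E →L[ℝ] E) (x : PreGNS Λ) : ‖act T x‖ ≤ ‖T‖ * ‖x‖ :=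
  norm_le_of_forall (norm_nonneg _) fun _ => T.le_opNorm _

/-- For finite-dimensional `E` the algebra `B(E)` is separable, and the space is spanned by a
continuous image of `B(E) × K`. -/
theorem separableSpace [FiniteDimensional ℝ E] [TopologicalSpace.SeparableSpace K]
    (h1 : ∀ k k', Λ.toLinearMap (formEval 1 k k') = inner ℝ k k') :
    TopologicalSpace.SeparableSpace (PreGNS Λ) := by
  let actₗ : (E →L[ℝ] E) →ₗ[ℝ] K →ₗ[ℝ] PreGNS Λ :=
    LinearMap.mk₂ ℝ (fun T k => act T (evalAt k))
      (fun _ _ _ => eval_injective (by ext u; simp))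
      (fun _ _ _ => eval_injective (by ext u; simp))
      (fun _ _ _ => by simp) (fun _ _ _ => by simp)
  have hcont : Continuous fun p : (E →L[ℝ] E) × K => act p.1 (evalAt p.2 : PreGNS Λ) :=
    (actₗ.mkContinuous₂ 1 fun T k => by
      rw [one_mul, ← norm_evalAt h1 k]
      exact norm_act_le T _).continuous₂
  have : TopologicalSpace.SeparableSpace (E →L[ℝ] E) := by
    have : ProperSpace (E →L[ℝ] E) := FiniteDimensional.proper ℝ _
    infer_instance
  have hsep := (TopologicalSpace.isSeparable_range hcont).span (R := ℝ)
  rw [span_act_evalAt] at hsep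
  exact TopologicalSpace.isSeparable_univ_iff.1 hsep

end PreGNS

end GNS

/-! ### The representation, and positive functionals with prescribed values -/

section Dilation

variable {E : Type u} [NormedAddCommGroup E] [InnerProductSpace ℝ E] [CompleteSpace E]
  {K : Type v} [NormedAddCommGroup K] [InnerProductSpace ℝ K]

open UniformSpace in
theorem completion_clm_ext {X Y : Type*} [SeminormedAddCommGroup X] [NormedSpace ℝ X]
    [NormedAddCommGroup Y] [NormedSpace ℝ Y] {S T : Completion X →L[ℝ] Y}
    (h : ∀ x : X, S x = T x) : S = T :=
  DFunLike.coe_injective (Completion.ext S.continuous T.continuous h)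

open UniformSpace in
/-- The representation of `B(E)` on the Hilbert space of a positive functional. -/
def gnsRep (Λ : PositiveFunctional E K) :
    (E →L[ℝ] E) →⋆ₙₐ[ℝ] (Completion (PreGNS Λ) →L[ℝ] Completion (PreGNS Λ)) where
  toFun T := (PreGNS.act T).completion
  map_smul' c T := completion_clm_ext fun x => by
    rw [ContinuousLinearMap.completion_apply_coe, MonoidHom.id_apply, smul_apply,
      ContinuousLinearMap.completion_apply_coe, ← Completion.coe_smul]
    rfl
  map_zero' := completion_clm_ext fun x => by
    rw [ContinuousLinearMap.completion_apply_coe, zero_apply, ← Completion.coe_zero]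
    rfl
  map_add' S T := completion_clm_ext fun x => by
    rw [add_apply, ContinuousLinearMap.completion_apply_coe,
      ContinuousLinearMap.completion_apply_coe, ContinuousLinearMap.completion_apply_coe,
      ← Completion.coe_add]
    rfl
  map_mul' S T := completion_clm_ext fun x => by
    rw [mul_apply_eq_comp, ContinuousLinearMap.completion_apply_coe,
      ContinuousLinearMap.completion_apply_coe, ContinuousLinearMap.completion_apply_coe]
    rfl
  map_star' T := by
    rw [ContinuousLinearMap.star_eq_adjoint (PreGNS.act T).completion,
      ContinuousLinearMap.eq_adjoint_iff]
    intro x y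
    induction x, y using Completion.induction_on₂ with
    | hp => exact isClosed_eq (by fun_prop) (by fun_prop)
    | ih x y =>
      simp only [ContinuousLinearMap.completion_apply_coe, Completion.inner_coe]
      exact PreGNS.inner_act_left T x y

open UniformSpace in
/-- A positive functional restricting to the inner product on `K` is implemented by a
representation of `B(E)` and an isometry. -/
theorem exists_isometry_starHom [TopologicalSpace.SeparableSpace K] (Λ : PositiveFunctional E K)
    (h1 : ∀ k k', Λ.toLinearMap (formEval 1 k k') = inner ℝ k k') :
    ∃ (G : Type (max u v)) (_ : NormedAddCommGroup G) (_ : InnerProductSpace ℝ G)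
      (_ : CompleteSpace G),
      (FiniteDimensional ℝ E → TopologicalSpace.SeparableSpace G) ∧
      ∃ (V : K →ₗᵢ[ℝ] G) (π : (E →L[ℝ] E) →⋆ₙₐ[ℝ] (G →L[ℝ] G)),
        ∀ T k k', inner ℝ (π T (V k)) (V k') = Λ.toLinearMap (formEval T k k') := by
  refine ⟨Completion (PreGNS Λ), inferInstance, inferInstance, inferInstance, fun _ => ?_,
    { toLinearMap := (Completion.toComplL (𝕜 := ℝ) (E := PreGNS Λ)).toLinearMap ∘ₗ PreGNS.evalAt
      norm_map' := fun k => ?_ }, gnsRep Λ, fun T k k' => ?_⟩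
  · have := PreGNS.separableSpace (Λ := Λ) h1
    infer_instance
  · exact (Completion.norm_coe _).trans (PreGNS.norm_evalAt h1 k)
  · change inner ℝ ((PreGNS.act T).completion (PreGNS.evalAt k : PreGNS Λ))
      ((PreGNS.evalAt k' : PreGNS Λ) : Completion (PreGNS Λ)) = _
    rw [ContinuousLinearMap.completion_apply_coe, Completion.inner_coe]
    rfl

omit [CompleteSpace E] in
/-- Extension of a matrix-positive assignment `B s ↦ A s` to a positive functional. -/
theorem exists_positiveFunctional {σ I : Type*} (b : Module.Basis I ℝ K) (B : σ → E →L[ℝ] E)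
    (A : σ → K →L[ℝ] K) (s₀ : σ) (hB : B s₀ = 1)
    (hpos : ∀ c : σ × I × I →₀ ℝ,
      (∀ u : K →ₗ[ℝ] E, 0 ≤ c.sum fun p r => r * inner ℝ (B p.1 (u (b p.2.1))) (u (b p.2.2))) →
        0 ≤ c.sum fun p r => r * inner ℝ (A p.1 (b p.2.1)) (b p.2.2)) :
    ∃ Λ : PositiveFunctional E K,
      ∀ s k k', Λ.toLinearMap (formEval (B s) k k') = inner ℝ (A s k) k' := by
  let C : PointedCone ℝ (dominated E K) :=
    { carrier := {m | ∀ u, 0 ≤ (m : (K →ₗ[ℝ] E) → ℝ) u}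
      zero_mem' := fun u => le_rfl
      add_mem' := fun hm hm' u => add_nonneg (hm u) (hm' u)
      smul_mem' := fun c m hm u => mul_nonneg c.2 (hm u) }
  -- Formal combinations serve as the domain, so no independence among the functions `formEval` is
  -- needed; well-definedness comes from positivity in `exists_nonneg_extension`.
  let j : (σ × I × I →₀ ℝ) →ₗ[ℝ] dominated E K :=
    Finsupp.linearCombination ℝ fun p => formEval (B p.1) (b p.2.1) (b p.2.2)
  let f : (σ × I × I →₀ ℝ) →ₗ[ℝ] ℝ :=
    Finsupp.linearCombination ℝ fun p => inner ℝ (A p.1 (b p.2.1)) (b p.2.2)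
  have hj : ∀ c u, (j c : (K →ₗ[ℝ] E) → ℝ) u =
      c.sum fun p r => r * inner ℝ (B p.1 (u (b p.2.1))) (u (b p.2.2)) := by
    intro c u
    simp only [j, Finsupp.linearCombination_apply, Finsupp.sum, Submodule.coe_sum,
      Finset.sum_apply, Submodule.coe_smul, Pi.smul_apply, formEval_apply, smul_eq_mul]
  have hrange : ∀ s k k', formEval (B s) k k' ∈ LinearMap.range j := by
    intro s k k'
    induction b.mem_span k using Submodule.span_induction with
    | mem x hx =>
      obtain ⟨i, rfl⟩ := hx
      induction b.mem_span k' using Submodule.span_induction with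
      | mem y hy =>
        obtain ⟨i', rfl⟩ := hy
        exact ⟨Finsupp.single (s, i, i') 1, by simp [j]⟩
      | zero => simp
      | add x y _ _ hx hy => rw [map_add]; exact Submodule.add_mem _ hx hy
      | smul r x _ hx => rw [map_smul]; exact Submodule.smul_mem _ _ hx
    | zero => simp
    | add x y _ _ hx hy => rw [map_add]; exact Submodule.add_mem _ hx hy
    | smul r x _ hx => rw [map_smul]; exact Submodule.smul_mem _ _ hx
  have hf : ∀ c, j c ∈ C → 0 ≤ f c := by
    intro c hc
    have h := hpos c fun u => by rw [← hj]; exact hc u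
    simpa [f, Finsupp.linearCombination_apply] using h
  -- The cofinality condition of Riesz extension: a dominated function is absorbed by a multiple of
  -- `∑ ‖u k‖ ^ 2`, which lies in the range of `j` because `B s₀ = 1`.
  have hdense : ∀ m, ∃ c, j c + m ∈ C := by
    rintro ⟨m, s, c, hc, h⟩
    have hmem : c • ∑ k ∈ s, formEval (B s₀) k k ∈ LinearMap.range j :=
      Submodule.smul_mem _ _ (Submodule.sum_mem _ fun k _ => hrange _ _ _)
    obtain ⟨d, hd⟩ := hmem
    refine ⟨d, fun u => ?_⟩
    have h1 := neg_le_of_abs_le (h u)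
    rw [hd, hB]
    simp only [Submodule.coe_add, Submodule.coe_smul, Submodule.coe_sum, Pi.add_apply,
      Pi.smul_apply, Finset.sum_apply, formEval_apply, one_apply_eq_self,
      real_inner_self_eq_norm_sq, smul_eq_mul]
    linarith
  obtain ⟨Λ, hΛ, hnonneg⟩ := exists_nonneg_extension C j f hf hdense
  refine ⟨⟨Λ, hnonneg⟩, fun s => ?_⟩
  have h : (formEval (B s)).compr₂ Λ = (innerₗ K).comp (A s).toLinearMap := by
    refine LinearMap.ext_basis b b fun i i' => ?_
    have := hΛ (Finsupp.single (s, i, i') 1)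
    simpa [j, f] using this
  exact fun k k' => LinearMap.congr_fun₂ h k k'

end Dilation

/-! ### Forms with matrix coefficients and homogenisation -/

section MatrixForm

variable {n : Type*} [Fintype n] {E : Type*} [NormedAddCommGroup E] [InnerProductSpace ℝ E]

/-- The quadratic form of `T ⊗ X` on `n`-tuples of vectors, for a real matrix `X`. -/
def matrixForm (T : E →L[ℝ] E) (X : Matrix n n ℝ) (x : n → E) : ℝ :=
  ∑ i, ∑ j, X i j * inner ℝ (T (x i)) (x j)

/-- The action of a real matrix on tuples of vectors. -/
def matrixAct (S : Matrix n n ℝ) (x : n → E) : n → E := fun a => ∑ i, S a i • x i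

theorem matrixAct_mul (S R : Matrix n n ℝ) (x : n → E) :
    matrixAct (S * R) x = matrixAct S (matrixAct R x) := by
  ext a
  simp only [matrixAct, Matrix.mul_apply, Finset.sum_smul, Finset.smul_sum, smul_smul]
  exact Finset.sum_comm

theorem matrixAct_one [DecidableEq n] (x : n → E) : matrixAct 1 x = x := by
  ext a
  simp [matrixAct, Matrix.one_apply]

/-- The Gram matrix of a tuple with respect to the form of an operator. -/
def formGram (T : E →L[ℝ] E) (x : n → E) : Matrix n n ℝ :=
  Matrix.of fun i j => inner ℝ (T (x i)) (x j)

theorem matrixForm_eq_trace (T : E →L[ℝ] E) (X : Matrix n n ℝ) (x : n → E) :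
    matrixForm T X x = (X * (formGram T x).transpose).trace := rfl

theorem formGram_matrixAct (T : E →L[ℝ] E) (S : Matrix n n ℝ) (x : n → E) :
    formGram T (matrixAct S x) = S * formGram T x * S.transpose := by
  ext i j
  simp only [formGram, matrixAct, Matrix.of_apply, Matrix.mul_apply, Matrix.transpose_apply,
    map_sum, map_smul, sum_inner, inner_sum, inner_smul_left, inner_smul_right, conj_trivial,
    Finset.sum_mul, Finset.mul_sum]
  refine Finset.sum_congr rfl fun a _ => Finset.sum_congr rfl fun b _ => ?_
  ring

/-- Cyclicity of the trace moves a change of tuple onto the coefficient matrix. The rule is the same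
over every space, so one `S` serves both `E` and `K`. -/
theorem matrixForm_congr (T : E →L[ℝ] E) (X S : Matrix n n ℝ) (x : n → E) :
    matrixForm T (S.transpose * X * S) x = matrixForm T X (matrixAct S x) := by
  simp only [matrixForm_eq_trace, formGram_matrixAct, Matrix.transpose_mul,
    Matrix.transpose_transpose]
  rw [mul_assoc, mul_assoc, Matrix.trace_mul_comm]
  simp only [mul_assoc]

theorem matrixForm_transpose {T : E →L[ℝ] E} (hT : T.IsSymmetric) (X : Matrix n n ℝ)
    (x : n → E) : matrixForm T X.transpose x = matrixForm T X x := by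
  have h : ∀ a b, inner ℝ (T a) b = inner ℝ (T b) a := fun a b =>
    (hT a b).trans (real_inner_comm _ _)
  rw [matrixForm, Finset.sum_comm, matrixForm]
  simp only [Matrix.transpose_apply, h (x _) (x _)]

theorem matrixForm_add (T : E →L[ℝ] E) (X Y : Matrix n n ℝ) (x : n → E) :
    matrixForm T (X + Y) x = matrixForm T X x + matrixForm T Y x := by
  simp [matrixForm, add_mul, Finset.sum_add_distrib]

theorem matrixForm_smul (T : E →L[ℝ] E) (c : ℝ) (X : Matrix n n ℝ) (x : n → E) :
    matrixForm T (c • X) x = c * matrixForm T X x := by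
  simp [matrixForm, Finset.mul_sum, mul_assoc]

/-- The symmetric part of a real matrix. -/
def symmPart (X : Matrix n n ℝ) : Matrix n n ℝ := (1 / 2 : ℝ) • (X + X.transpose)

omit [Fintype n] in
theorem isSymm_symmPart (X : Matrix n n ℝ) : (symmPart X).IsSymm := by
  simp [symmPart, Matrix.IsSymm, add_comm]

theorem matrixForm_symmPart {T : E →L[ℝ] E} (hT : T.IsSymmetric) (X : Matrix n n ℝ)
    (x : n → E) : matrixForm T (symmPart X) x = matrixForm T X x := by
  rw [symmPart, matrixForm_smul, matrixForm_add, matrixForm_transpose hT]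
  ring

theorem matrixForm_one_one [DecidableEq n] (x : n → E) :
    matrixForm 1 1 x = ∑ i, ‖x i‖ ^ 2 := by
  simp [matrixForm, Matrix.one_apply]

theorem matrixForm_smul_const (T : E →L[ℝ] E) (X : Matrix n n ℝ) (t : n → ℝ) (e : E) :
    matrixForm T X (fun i => t i • e) = t ⬝ᵥ X.mulVec t * inner ℝ (T e) e := by
  simp only [matrixForm, map_smul, inner_smul_left, inner_smul_right, conj_trivial, dotProduct,
    Matrix.mulVec, Finset.mul_sum, Finset.sum_mul]
  refine Finset.sum_congr rfl fun i _ => Finset.sum_congr rfl fun j _ => ?_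
  ring

open scoped MatrixOrder in
theorem exists_isUnit_eq_transpose_mul_self [DecidableEq n] {C : Matrix n n ℝ} (hC : C.PosDef) :
    ∃ S : Matrix n n ℝ, IsUnit S ∧ C = S.transpose * S := by
  obtain ⟨S, hS⟩ := CStarAlgebra.nonneg_iff_eq_star_mul_self.1 hC.posSemidef.nonneg
  refine ⟨S, ?_, hS⟩
  have := hC.det_pos
  rw [hS, Matrix.det_mul] at this
  exact (Matrix.isUnit_iff_isUnit_det S).2 (isUnit_iff_ne_zero.2 (right_ne_zero_of_mul this.ne'))

variable {K : Type*} [NormedAddCommGroup K] [InnerProductSpace ℝ K] {ι : Type*} [Fintype ι]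

/-- Monic positivity for symmetric coefficient matrices implies positivity for arbitrary
coefficient matrices, provided positivity of `c + ∑ l, y l • B l` forces `0 ≤ c`. -/
theorem matrixForm_nonneg_of_monic [DecidableEq n] {B : ι → E →L[ℝ] E} {A : ι → K →L[ℝ] K}
    (hB : ∀ l, (B l).IsSymmetric) (hA : ∀ l, (A l).IsSymmetric)
    (hconst : ∀ (c : ℝ) (y : ι → ℝ),
      (∀ e : E, 0 ≤ c * ‖e‖ ^ 2 + ∑ l, y l * inner ℝ (B l e) e) → 0 ≤ c)
    (hmonic : ∀ X : ι → Matrix n n ℝ, (∀ l, (X l).IsSymm) →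
      (∀ x : n → E, 0 ≤ matrixForm 1 1 x + ∑ l, matrixForm (B l) (X l) x) →
        ∀ m : n → K, 0 ≤ matrixForm 1 1 m + ∑ l, matrixForm (A l) (X l) m)
    (C : Matrix n n ℝ) (X : ι → Matrix n n ℝ)
    (hpos : ∀ x : n → E, 0 ≤ matrixForm 1 C x + ∑ l, matrixForm (B l) (X l) x) (m : n → K) :
    0 ≤ matrixForm 1 C m + ∑ l, matrixForm (A l) (X l) m := by
  have hA1 : (1 : K →L[ℝ] K).IsSymmetric := fun _ _ => rfl
  have hB1 : (1 : E →L[ℝ] E).IsSymmetric := fun _ _ => rfl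
  let C' := symmPart C
  let X' := fun l => symmPart (X l)
  have hpos' : ∀ x : n → E, 0 ≤ matrixForm 1 C' x + ∑ l, matrixForm (B l) (X' l) x := by
    intro x
    simpa only [C', X', matrixForm_symmPart hB1, matrixForm_symmPart (hB _)] using hpos x
  suffices h : 0 ≤ matrixForm 1 C' m + ∑ l, matrixForm (A l) (X' l) m by
    simpa only [C', X', matrixForm_symmPart hA1, matrixForm_symmPart (hA _)] using h
  -- Tuples `t i • e` along a single vector reduce matrix coefficients to scalars, where `hconst`
  -- applies with `c = t ⬝ᵥ C' t`.
  have hC' : C'.PosSemidef := by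
    refine Matrix.PosSemidef.of_dotProduct_mulVec_nonneg (isSymm_symmPart C) fun t => ?_
    refine hconst _ (fun l => t ⬝ᵥ (X' l).mulVec t) fun e => ?_
    simpa only [matrixForm_smul_const, one_apply_eq_self, real_inner_self_eq_norm_sq, star_trivial]
      using hpos' fun i => t i • e
  -- `C'` may be singular; `C' + ε` factors as `Sᵀ S` with `S` invertible, and substituting by `S⁻¹`
  -- makes the constant term `1`.
  have key : ∀ ε : ℝ, 0 < ε →
      0 ≤ matrixForm 1 C' m + ∑ l, matrixForm (A l) (X' l) m + ε * matrixForm 1 1 m := by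
    intro ε hε
    obtain ⟨S, hS, hCS⟩ := exists_isUnit_eq_transpose_mul_self
      (Matrix.PosDef.posSemidef_add hC' (Matrix.PosDef.one.smul hε))
    have hdet := (Matrix.isUnit_iff_isUnit_det S).1 hS
    let R := S⁻¹
    have hRS : R * S = 1 := Matrix.nonsing_inv_mul S hdet
    have hSR : S * R = 1 := Matrix.mul_nonsing_inv S hdet
    let Z := fun l => R.transpose * X' l * R
    have hXZ : ∀ l, X' l = S.transpose * Z l * S := by
      intro l
      have h1 : S.transpose * R.transpose = 1 := by
        rw [← Matrix.transpose_mul, hRS, Matrix.transpose_one]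
      calc X' l = (S.transpose * R.transpose) * X' l * (R * S) := by
            rw [h1, hRS, one_mul, mul_one]
        _ = _ := by simp only [Z, mul_assoc]
    have hZsymm : ∀ l, (Z l).IsSymm := by
      intro l
      have := (isSymm_symmPart (X l)).eq
      simp only [Z, X', Matrix.IsSymm, Matrix.transpose_mul, Matrix.transpose_transpose, this,
        mul_assoc]
    have hCE : ∀ z : n → E, matrixForm 1 C' z + ε * matrixForm 1 1 z =
        matrixForm 1 1 (matrixAct S z) := by
      intro z
      rw [← matrixForm_congr, mul_one, ← hCS, matrixForm_add, matrixForm_smul]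
    have hCK : ∀ z : n → K, matrixForm 1 C' z + ε * matrixForm 1 1 z =
        matrixForm 1 1 (matrixAct S z) := by
      intro z
      rw [← matrixForm_congr, mul_one, ← hCS, matrixForm_add, matrixForm_smul]
    have h := hmonic Z hZsymm (fun x => ?_) (matrixAct S m)
    · simp only [← matrixForm_congr _ (Z _), ← hXZ] at h
      rw [← hCK] at h
      linarith
    · have hx : x = matrixAct S (matrixAct R x) := by
        rw [← matrixAct_mul, hSR, matrixAct_one]
      rw [hx, ← hCE]
      simp only [← matrixForm_congr _ (Z _), ← hXZ]
      have h1 := hpos' (matrixAct R x)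
      have h2 : 0 ≤ matrixForm 1 1 (matrixAct R x) := by
        rw [matrixForm_one_one]
        positivity
      nlinarith
  have h2 : 0 ≤ matrixForm 1 1 m := by
    rw [matrixForm_one_one]
    positivity
  refine le_of_forall_pos_le_add fun δ hδ => ?_
  -- This `ε` makes the error at most `δ`; the `+ 1` avoids dividing by zero when `m = 0`.
  have h3 := key (δ / (matrixForm 1 1 m + 1)) (by positivity)
  have h4 : δ / (matrixForm 1 1 m + 1) * matrixForm 1 1 m ≤ δ := by
    rw [div_mul_eq_mul_div, div_le_iff₀ (by positivity)]
    nlinarith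
  linarith

end MatrixForm

/-! ### Real matrices as operators on a finite-dimensional space -/

section OrthonormalBasis

variable {n : Type*} [Fintype n] {F : Type*} [NormedAddCommGroup F] [InnerProductSpace ℝ F]

/-- The operator with a given real matrix in an orthonormal basis. -/
def matrixOperator (f : OrthonormalBasis n ℝ F) (X : Matrix n n ℝ) : F →L[ℝ] F :=
  ∑ i, ∑ j, X i j • (innerSL ℝ (f i)).smulRight (f j)

theorem inner_matrixOperator (f : OrthonormalBasis n ℝ F) (X : Matrix n n ℝ) (y z : F) :
    inner ℝ (matrixOperator f X y) z =
      ∑ i, ∑ j, X i j * (inner ℝ (f i) y * inner ℝ (f j) z) := by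
  simp [matrixOperator, sum_apply, sum_inner, inner_smul_left]

theorem isSymmetric_matrixOperator (f : OrthonormalBasis n ℝ F) {X : Matrix n n ℝ}
    (hX : X.IsSymm) : (matrixOperator f X).IsSymmetric := by
  intro y z
  refine (inner_matrixOperator f X y z).trans
    (Eq.trans ?_ ((inner_matrixOperator f X z y).symm.trans (real_inner_comm _ _)))
  rw [Finset.sum_comm]
  refine Finset.sum_congr rfl fun i _ => Finset.sum_congr rfl fun j _ => ?_
  rw [hX.apply, mul_comm (inner ℝ (f j) y)]

theorem inner_matrixOperator_basis [DecidableEq n] (f : OrthonormalBasis n ℝ F)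
    (X : Matrix n n ℝ) (i j : n) : inner ℝ (matrixOperator f X (f i)) (f j) = X i j := by
  simp [inner_matrixOperator, f.inner_eq_ite]

variable {ι : Type*} [Fintype ι] {E : Type*} [NormedAddCommGroup E] [InnerProductSpace ℝ E]

theorem inner_monicPencil_basis [DecidableEq n] (f : OrthonormalBasis n ℝ F) (A : ι → E →L[ℝ] E)
    (X : ι → Matrix n n ℝ) (x : n → E) :
    inner ℝ (monicPencil A (fun l => matrixOperator f (X l)) (∑ i, x i ⊗ₜ[ℝ] f i))
        (∑ i, x i ⊗ₜ[ℝ] f i) = matrixForm 1 1 x + ∑ l, matrixForm (A l) (X l) x := by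
  rw [inner_monicPencil_sum]
  simp only [inner_matrixOperator_basis, Finset.sum_add_distrib]
  congr 1
  · simp [matrixForm, Matrix.one_apply, f.inner_eq_ite]
  · simp only [matrixForm]
    rw [eq_comm, Finset.sum_comm]
    refine Finset.sum_congr rfl fun i _ => ?_
    rw [Finset.sum_comm]
    exact Finset.sum_congr rfl fun j _ => Finset.sum_congr rfl fun l _ => mul_comm _ _

theorem exists_eq_sum_tmul_basis (f : OrthonormalBasis n ℝ F) (v : E ⊗[ℝ] F) :
    ∃ x : n → E, v = ∑ i, x i ⊗ₜ[ℝ] f i := by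
  induction v with
  | zero => exact ⟨0, by simp⟩
  | add a b ha hb =>
    obtain ⟨x, rfl⟩ := ha
    obtain ⟨y, rfl⟩ := hb
    exact ⟨x + y, by simp [TensorProduct.add_tmul, Finset.sum_add_distrib]⟩
  | tmul a b =>
    refine ⟨fun i => (inner ℝ (f i) b : ℝ) • a, ?_⟩
    conv_lhs => rw [← f.sum_repr' b, TensorProduct.tmul_sum]
    simp [TensorProduct.smul_tmul]

theorem isPositive_monicPencil_matrixOperator [DecidableEq n] (f : OrthonormalBasis n ℝ F)
    {B : ι → E →L[ℝ] E} (hB : ∀ l, (B l).IsSymmetric) {X : ι → Matrix n n ℝ}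
    (hX : ∀ l, (X l).IsSymm)
    (h : ∀ x : n → E, 0 ≤ matrixForm 1 1 x + ∑ l, matrixForm (B l) (X l) x) :
    (monicPencil B fun l => matrixOperator f (X l)).IsPositive := by
  refine ⟨isSymmetric_monicPencil hB fun l => isSymmetric_matrixOperator f (hX l), fun v => ?_⟩
  obtain ⟨x, rfl⟩ := exists_eq_sum_tmul_basis f v
  rw [ContinuousLinearMap.reApplyInnerSelf_apply, RCLike.re_to_real, inner_monicPencil_basis]
  exact h x

end OrthonormalBasis

/-! ### From the polar dual to matrix inequalities -/

section PolarDualForm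

variable {ι : Type*} [Fintype ι] {H : Type*} [NormedAddCommGroup H] [InnerProductSpace ℝ H]
  {𝒦 : Type*} [NormedAddCommGroup 𝒦] [InnerProductSpace ℝ 𝒦] [CompleteSpace 𝒦]

/-- Membership in the polar dual of a spectrahedron, expressed by real symmetric matrices of a size
not exceeding the dimension of `K`. -/
theorem matrixForm_nonneg_of_mem_polarDual {B : ι → H →L[ℝ] H} (hB : ∀ l, (B l).IsSymmetric)
    {K : ClosedSubmodule ℝ 𝒦} {A : ι → K.toSubmodule →L[ℝ] K.toSubmodule}
    (hA : A ∈ polarDual (spectrahedron 𝒦 B) K) {n : Type*} [Fintype n] [DecidableEq n]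
    {k : n → K.toSubmodule} (hk : LinearIndependent ℝ k) {X : ι → Matrix n n ℝ}
    (hX : ∀ l, (X l).IsSymm)
    (h : ∀ x : n → H, 0 ≤ matrixForm 1 1 x + ∑ l, matrixForm (B l) (X l) x)
    (m : n → K.toSubmodule) : 0 ≤ matrixForm 1 1 m + ∑ l, matrixForm (A l) (X l) m := by
  have hk' : LinearIndependent ℝ fun i => (k i : 𝒦) :=
    hk.map' K.toSubmodule.subtype (Submodule.ker_subtype _)
  -- Only subspaces of `𝒦` are available for testing. Independence of `k` supplies one of dimension
  -- exactly `n`, on which the matrices `X l` become operators; the vectors `k` play no further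
  -- role.
  let S := Submodule.span ℝ (Set.range fun i => (k i : 𝒦))
  have hfin : FiniteDimensional ℝ S := FiniteDimensional.span_of_finite ℝ (Set.finite_range _)
  let K' : ClosedSubmodule ℝ 𝒦 := ⟨S, S.closed_of_finiteDimensional⟩
  have hcard : Module.finrank ℝ S = Fintype.card n := finrank_span_eq_card hk'
  let f : OrthonormalBasis n ℝ K'.toSubmodule :=
    (stdOrthonormalBasis ℝ S).reindex ((finCongr hcard).trans (Fintype.equivFin n).symm)
  have hpos := hA.2 K' (fun l => matrixOperator f (X l))
    ⟨fun l => ContinuousLinearMap.isSelfAdjoint_iff_isSymmetric.2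
      (isSymmetric_matrixOperator f (hX l)), isPositive_monicPencil_matrixOperator f hB hX h⟩
  rw [← inner_monicPencil_basis f]
  exact hpos.inner_nonneg_left _

end PolarDualForm

/-! ### From matrix inequalities to a compression -/

section Dilation

variable {ι : Type*} [Fintype ι] {E : Type u} [NormedAddCommGroup E] [InnerProductSpace ℝ E]
  [CompleteSpace E] {K : Type v} [NormedAddCommGroup K] [InnerProductSpace ℝ K] [CompleteSpace K]
  [TopologicalSpace.SeparableSpace K]

/-- If monic matrix positivity for `B` implies it for `A`, and positivity of
`c + ∑ l, y l • B l` forces `0 ≤ c`, then `A` is a compression of a representation of `B`. -/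
theorem exists_compression_of_monic {B : ι → E →L[ℝ] E} {A : ι → K →L[ℝ] K}
    (hB : ∀ l, (B l).IsSymmetric) (hA : ∀ l, (A l).IsSymmetric)
    (hconst : ∀ (c : ℝ) (y : ι → ℝ),
      (∀ e : E, 0 ≤ c * ‖e‖ ^ 2 + ∑ l, y l * inner ℝ (B l e) e) → 0 ≤ c)
    (hmonic : ∀ (n : Type v) [Fintype n] [DecidableEq n] (k : n → K), LinearIndependent ℝ k →
      ∀ X : ι → Matrix n n ℝ, (∀ l, (X l).IsSymm) →
        (∀ x : n → E, 0 ≤ matrixForm 1 1 x + ∑ l, matrixForm (B l) (X l) x) →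
          ∀ m : n → K, 0 ≤ matrixForm 1 1 m + ∑ l, matrixForm (A l) (X l) m) :
    ∃ (G : Type (max u v)) (_ : NormedAddCommGroup G) (_ : InnerProductSpace ℝ G)
      (_ : CompleteSpace G),
      (FiniteDimensional ℝ E → TopologicalSpace.SeparableSpace G) ∧
      ∃ (V : K →ₗᵢ[ℝ] G) (π : (E →L[ℝ] E) →⋆ₙₐ[ℝ] (G →L[ℝ] G)),
        ∀ l, A l = ContinuousLinearMap.adjoint V.toContinuousLinearMap ∘L π (B l) ∘L
          V.toContinuousLinearMap := by
  classical
  let b := Module.Basis.ofVectorSpace ℝ K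
  -- The index `none` carries the unit, so that the value of `Λ` on it makes `V` isometric.
  let B' : Option ι → E →L[ℝ] E := fun o => o.elim 1 B
  let A' : Option ι → K →L[ℝ] K := fun o => o.elim 1 A
  obtain ⟨Λ, hΛ⟩ := exists_positiveFunctional b B' A' none rfl (fun c hc => by
    -- The finitely many Hamel basis vectors occurring in `c`; restricted to them, `c` is a family
    -- of real matrices.
    let s : Finset (Module.Basis.ofVectorSpaceIndex ℝ K) :=
      c.support.image (fun p => p.2.1) ∪ c.support.image (fun p => p.2.2)
    have hs : c.support ⊆ Finset.univ ×ˢ s ×ˢ s := by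
      intro p hp
      simp only [s, Finset.mem_product, Finset.mem_univ, true_and, Finset.mem_union,
        Finset.mem_image]
      exact ⟨Or.inl ⟨p, hp, rfl⟩, Or.inr ⟨p, hp, rfl⟩⟩
    let X : Option ι → Matrix s s ℝ := fun o => Matrix.of fun i j => c (o, i, j)
    have hsum : ∀ φ : Option ι × _ × _ → ℝ, (c.sum fun p r => r * φ p) =
        ∑ o, ∑ i : s, ∑ j : s, X o i j * φ (o, i, j) := by
      intro φ
      rw [Finsupp.sum_of_support_subset c hs _ (by simp), Finset.sum_product]
      refine Finset.sum_congr rfl fun o _ => ?_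
      rw [Finset.sum_product, ← Finset.sum_coe_sort s]
      refine Finset.sum_congr rfl fun i _ => ?_
      rw [← Finset.sum_coe_sort s]
      rfl
    have hform := matrixForm_nonneg_of_monic (n := s) hB hA hconst
      (hmonic s (fun i => b i) (b.linearIndependent.comp _ Subtype.val_injective))
      (X none) (fun l => X (some l)) (fun x => by
        -- Any tuple in `E` is the image of these basis vectors under some linear map, since no
        -- continuity is asked of `u`.
        let u : K →ₗ[ℝ] E := b.constr ℝ fun i => if h : i ∈ s then x ⟨i, h⟩ else 0
        have hu : ∀ i : s, u (b i) = x i := by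
          intro i
          simp [u, b.constr_basis]
        have h := hc u
        rw [hsum fun p => inner ℝ (B' p.1 (u (b p.2.1))) (u (b p.2.2)), Fintype.sum_option] at h
        simp only [hu] at h
        exact h) (fun i => b i)
    rw [hsum fun p => inner ℝ (A' p.1 (b p.2.1)) (b p.2.2), Fintype.sum_option]
    exact hform)
  obtain ⟨G, i1, i2, i3, hsep, V, π, hπ⟩ := exists_isometry_starHom Λ (fun k k' => hΛ none k k')
  refine ⟨G, i1, i2, i3, hsep, V, π, fun l => ?_⟩
  ext1 k
  refine ext_inner_right ℝ fun k' => ?_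
  rw [ContinuousLinearMap.comp_apply, ContinuousLinearMap.adjoint_inner_left]
  exact ((hπ (B l) k k').trans (hΛ (some l) k k')).symm

end Dilation

section OplusZeroForm

variable {H : Type*} [NormedAddCommGroup H] [InnerProductSpace ℝ H] {n : Type*} [Fintype n]

theorem matrixForm_oplusZero (T : H →L[ℝ] H) (X : Matrix n n ℝ) (x : n → H) :
    matrixForm (oplusZero T) X (fun i => WithLp.toLp 2 (x i, (0 : ℝ))) = matrixForm T X x := by
  simp only [matrixForm, inner_oplusZero, WithLp.toLp_fst]

theorem matrixForm_one_toLp (X : Matrix n n ℝ) (x : n → H) :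
    matrixForm 1 X (fun i => WithLp.toLp 2 (x i, (0 : ℝ))) = matrixForm 1 X x := by
  simp [matrixForm, WithLp.prod_inner_apply]

end OplusZeroForm

/-! ### Boundedness of the shadow -/

section Shadow

variable {H : Type*} [NormedAddCommGroup H] [InnerProductSpace ℝ H] [CompleteSpace H]
  {ι κ : Type*} [Fintype ι] [Fintype κ]

/-- If the shadow is bounded and there is at least one variable `x`, then positivity of
`c + ∑ j, y j • Ω j + ∑ k, y k • Γ k` forces `0 ≤ c`. -/
theorem nonneg_of_isBounded_shadow [Nonempty ι] {Ω : ι → H →L[ℝ] H} {Γ : κ → H →L[ℝ] H}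
    (hΩ : ∀ j, IsSelfAdjoint (Ω j)) (hΓ : ∀ k, IsSelfAdjoint (Γ k))
    (hbdd : Bornology.IsBounded (shadow Ω Γ)) (c : ℝ) (y : ι ⊕ κ → ℝ)
    (hpos : ∀ e : H, 0 ≤ c * ‖e‖ ^ 2 + ∑ l, y l * inner ℝ (Sum.elim Ω Γ l e) e) : 0 ≤ c := by
  by_contra! hc
  obtain ⟨R, hR⟩ := hbdd.exists_norm_le
  -- If `c < 0`, the direction `y` gives an operator bounded below by `-c > 0`, so a large multiple
  -- of it absorbs any prescribed `x`.
  have hmem : ∀ (x : EuclideanSpace ℝ ι) (t : ℝ), 0 ≤ t → ∑ j, |x j| * ‖Ω j‖ ≤ t * -c →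
      x + t • WithLp.toLp 2 (fun j => y (Sum.inl j)) ∈ shadow Ω Γ := by
    intro x t ht hle
    refine ⟨t • WithLp.toLp 2 (fun k => y (Sum.inr k)), ?_⟩
    rw [ContinuousLinearMap.isPositive_iff']
    refine ⟨?_, fun e => ?_⟩
    · refine ((IsSelfAdjoint.one _).add (isSelfAdjoint_sum _ fun j _ => ?_)).add
        (isSelfAdjoint_sum _ fun k _ => ?_)
      · exact (IsSelfAdjoint.all _).smul (hΩ j)
      · exact (IsSelfAdjoint.all _).smul (hΓ k)
    · have h1 := mul_nonneg ht (hpos e)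
      have h2 : -((∑ j, |x j| * ‖Ω j‖) * ‖e‖ ^ 2) ≤ ∑ j, x j * inner ℝ (Ω j e) e := by
        rw [Finset.sum_mul, ← Finset.sum_neg_distrib]
        refine Finset.sum_le_sum fun j _ => ?_
        have h3 : |inner ℝ (Ω j e) e| ≤ ‖Ω j‖ * ‖e‖ ^ 2 := by
          calc |inner ℝ (Ω j e) e| ≤ ‖Ω j e‖ * ‖e‖ := abs_real_inner_le_norm _ _
            _ ≤ ‖Ω j‖ * ‖e‖ * ‖e‖ := by gcongr; exact (Ω j).le_opNorm e
            _ = _ := by ring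
        have h4 := mul_le_mul_of_nonneg_left h3 (abs_nonneg (x j))
        rw [← abs_mul] at h4
        have h5 := neg_abs_le (x j * inner ℝ (Ω j e) e)
        linarith
      have h6 := mul_le_mul_of_nonneg_right hle (sq_nonneg ‖e‖)
      have h7 : inner ℝ (((1 : H →L[ℝ] H) +
          ∑ j, (x + t • WithLp.toLp 2 fun j => y (Sum.inl j)) j • Ω j +
          ∑ k, (t • WithLp.toLp 2 fun k => y (Sum.inr k) : EuclideanSpace ℝ κ) k • Γ k) e) e =
          ‖e‖ ^ 2 + ∑ j, x j * inner ℝ (Ω j e) e +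
            t * ∑ l, y l * inner ℝ (Sum.elim Ω Γ l e) e := by
        simp only [add_apply, sum_apply, smul_apply, inner_add_left, sum_inner, inner_smul_left,
          conj_trivial, one_apply_eq_self, real_inner_self_eq_norm_sq, Fintype.sum_sum_type,
          Sum.elim_inl, Sum.elim_inr, PiLp.add_apply, PiLp.smul_apply, smul_eq_mul, add_mul,
          Finset.sum_add_distrib, mul_add, Finset.mul_sum, mul_assoc, add_assoc]
      rw [h7]
      nlinarith [sq_nonneg ‖e‖]
  obtain ⟨j₀⟩ := ‹Nonempty ι›
  classical
  -- The same `t` works for `x` and `-x`. The two resulting points of the shadow differ by `2 x`, of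
  -- norm `2 (R + 1) > 2 R`.
  let x : EuclideanSpace ℝ ι := EuclideanSpace.single j₀ (R + 1)
  let t : ℝ := (∑ j, |x j| * ‖Ω j‖) / -c
  have hc' : 0 < -c := by linarith
  have ht : 0 ≤ t := by positivity
  have htc : t * -c = ∑ j, |x j| * ‖Ω j‖ := div_mul_cancel₀ _ hc'.ne'
  have h1 := hR _ (hmem x t ht htc.ge)
  have h2 := hR _ (hmem (-x) t ht (by simp [htc]))
  have hR0 : 0 ≤ R := (norm_nonneg _).trans h1
  have h3 : (2 : ℝ) * ‖x‖ ≤ R + R := by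
    calc (2 : ℝ) * ‖x‖ = ‖(2 : ℝ) • x‖ := by rw [norm_smul, Real.norm_ofNat]
      _ = ‖(x + t • WithLp.toLp 2 fun j => y (Sum.inl j)) -
          (-x + t • WithLp.toLp 2 fun j => y (Sum.inl j))‖ := by congr 1; rw [two_smul]; abel
      _ ≤ _ := (norm_sub_le _ _).trans (add_le_add h1 h2)
  have h4 : ‖x‖ = R + 1 := by
    simp only [x, EuclideanSpace.single, PiLp.norm_single, Real.norm_eq_abs]
    exact abs_of_nonneg (by linarith)
  linarith

end Shadow

/-! ### Assembling the descriptions of the polar dual -/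

section Compressions

variable {H : Type u} [NormedAddCommGroup H] [InnerProductSpace ℝ H] [CompleteSpace H]
  {𝒦 : Type v} [NormedAddCommGroup 𝒦] [InnerProductSpace ℝ 𝒦] [CompleteSpace 𝒦]
  {ι κ : Type*} [Fintype ι] [Fintype κ] {Ω : ι → H →L[ℝ] H} {Γ : κ → H →L[ℝ] H}

omit [Fintype ι] [Fintype κ] in
theorem isSelfAdjoint_sumElim (hΩ : ∀ j, IsSelfAdjoint (Ω j)) (hΓ : ∀ k, IsSelfAdjoint (Γ k))
    (l : ι ⊕ κ) : IsSelfAdjoint (Sum.elim Ω Γ l) := by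
  rcases l with j | k
  exacts [hΩ j, hΓ k]

omit [CompleteSpace H] in
theorem mem_polarDual_projX {K : ClosedSubmodule ℝ 𝒦}
    {A : ι → K.toSubmodule →L[ℝ] K.toSubmodule} :
    A ∈ polarDual (projX (spectrahedron 𝒦 (Sum.elim Ω Γ))) K ↔ (∀ j, IsSelfAdjoint (A j)) ∧
      Sum.elim A (fun _ : κ => 0) ∈ polarDual (spectrahedron 𝒦 (Sum.elim Ω Γ)) K := by
  rw [polarDual_projX]
  rfl

omit [CompleteSpace H] in
/-- Compressions of images of a tuple whose pencil is positive on the spectrahedron belong to the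
polar dual of the projected spectrahedron. -/
theorem mem_polarDual_projX_of_compressions {E : Type u} [NormedAddCommGroup E]
    [InnerProductSpace ℝ E] [CompleteSpace E] {Ω' : ι → E →L[ℝ] E} {Γ' : κ → E →L[ℝ] E}
    (hΩ' : ∀ j, IsSelfAdjoint (Ω' j)) (hΓ' : ∀ k, IsSelfAdjoint (Γ' k))
    (hpos : ∀ (K' : ClosedSubmodule ℝ 𝒦), ∀ Z ∈ spectrahedron 𝒦 (Sum.elim Ω Γ) K',
      (monicPencil (Sum.elim Ω' Γ') Z).IsPositive)
    {K : ClosedSubmodule ℝ 𝒦} {A : ι → K.toSubmodule →L[ℝ] K.toSubmodule}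
    (hA : A ∈ compressions Ω' Γ' K.toSubmodule) :
    A ∈ polarDual (projX (spectrahedron 𝒦 (Sum.elim Ω Γ))) K := by
  obtain ⟨hsa, G, _, _, _, -, V, π, hΩA, hΓA⟩ := hA
  have hA0 : ∀ l, IsSelfAdjoint
      (Sum.elim A (fun _ : κ => (0 : K.toSubmodule →L[ℝ] K.toSubmodule)) l) :=
    isSelfAdjoint_sumElim hsa fun _ => IsSelfAdjoint.zero _
  rw [mem_polarDual_projX]
  refine ⟨hsa, hA0, fun K' Z hZ => ?_⟩
  refine isPositive_monicPencil_compression (isSelfAdjoint_sumElim hΩ' hΓ') hA0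
    (fun l => ContinuousLinearMap.isSelfAdjoint_iff_isSymmetric.1 (hZ.1 l)) V π ?_ (hpos K' Z hZ)
  rintro (j | k)
  exacts [hΩA j, hΓA k]

/-- A member of the polar dual of the projected spectrahedron is a compression of a representation
of any tuple whose matrix positivity entails that of `(Ω, Γ)`. -/
theorem mem_compressions_of_mem_polarDual [TopologicalSpace.SeparableSpace 𝒦] {E : Type u}
    [NormedAddCommGroup E] [InnerProductSpace ℝ E] [CompleteSpace E] {Ω' : ι → E →L[ℝ] E}
    {Γ' : κ → E →L[ℝ] E} (hΩ : ∀ j, IsSelfAdjoint (Ω j)) (hΓ : ∀ k, IsSelfAdjoint (Γ k))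
    (hΩ' : ∀ j, IsSelfAdjoint (Ω' j)) (hΓ' : ∀ k, IsSelfAdjoint (Γ' k))
    (hconst : ∀ (c : ℝ) (y : ι ⊕ κ → ℝ),
      (∀ e : E, 0 ≤ c * ‖e‖ ^ 2 + ∑ l, y l * inner ℝ (Sum.elim Ω' Γ' l e) e) → 0 ≤ c)
    (hform : ∀ (n : Type v) [Fintype n] [DecidableEq n] (X : ι ⊕ κ → Matrix n n ℝ),
      (∀ x : n → E, 0 ≤ matrixForm 1 1 x + ∑ l, matrixForm (Sum.elim Ω' Γ' l) (X l) x) →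
        ∀ x : n → H, 0 ≤ matrixForm 1 1 x + ∑ l, matrixForm (Sum.elim Ω Γ l) (X l) x)
    {K : ClosedSubmodule ℝ 𝒦} {A : ι → K.toSubmodule →L[ℝ] K.toSubmodule}
    (hA : A ∈ polarDual (projX (spectrahedron 𝒦 (Sum.elim Ω Γ))) K) :
    A ∈ compressions Ω' Γ' K.toSubmodule := by
  rw [mem_polarDual_projX] at hA
  obtain ⟨hsa, hA⟩ := hA
  have hsymm := fun l => ContinuousLinearMap.isSelfAdjoint_iff_isSymmetric.1
    (isSelfAdjoint_sumElim hΩ hΓ l)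
  have hsymm' := fun l => ContinuousLinearMap.isSelfAdjoint_iff_isSymmetric.1
    (isSelfAdjoint_sumElim hΩ' hΓ' l)
  obtain ⟨G, i1, i2, i3, hsep, V, π, h⟩ := exists_compression_of_monic hsymm'
    (fun l => ContinuousLinearMap.isSelfAdjoint_iff_isSymmetric.1 (hA.1 l)) hconst
    fun n _ _ k hk X hX hx => matrixForm_nonneg_of_mem_polarDual hsymm hA hk hX (hform n X hx)
  exact ⟨hsa, G, i1, i2, i3, hsep, V, π, fun j => h (Sum.inl j), fun k => h (Sum.inr k)⟩

omit [CompleteSpace H] [Fintype ι] [Fintype κ] in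
theorem sumElim_oplusZero : Sum.elim (fun j => oplusZero (Ω j)) (fun k => oplusZero (Γ k)) =
    fun l => oplusZero (Sum.elim Ω Γ l) := by
  ext1 l
  rcases l with j | k <;> rfl

theorem polarDual_projX_eq_compressions_oplusZero [TopologicalSpace.SeparableSpace 𝒦]
    (hΩ : ∀ j, IsSelfAdjoint (Ω j)) (hΓ : ∀ k, IsSelfAdjoint (Γ k)) (K : ClosedSubmodule ℝ 𝒦) :
    polarDual (projX (spectrahedron 𝒦 (Sum.elim Ω Γ))) K =
      compressions (fun j => oplusZero (Ω j)) (fun k => oplusZero (Γ k)) K.toSubmodule := by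
  have hΩ' := fun j => isSelfAdjoint_oplusZero (hΩ j)
  have hΓ' := fun k => isSelfAdjoint_oplusZero (hΓ k)
  refine Set.Subset.antisymm (fun A hA => ?_) fun A hA => ?_
  · refine mem_compressions_of_mem_polarDual hΩ hΓ hΩ' hΓ' (fun c y h => ?_)
      (fun n _ _ X h x => ?_) hA
    -- All coefficients vanish on the added unit vector, so the form there is just `c`.
    · have h1 := h (WithLp.toLp 2 (0, 1))
      simp only [sumElim_oplusZero, inner_oplusZero] at h1
      simpa [WithLp.prod_norm_sq_eq_of_L2] using h1
    · have h1 := h fun i => WithLp.toLp 2 (x i, 0)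
      simpa only [sumElim_oplusZero, matrixForm_oplusZero, matrixForm_one_toLp] using h1
  · refine mem_polarDual_projX_of_compressions hΩ' hΓ' (fun K' Z hZ => ?_) hA
    rw [sumElim_oplusZero]
    exact isPositive_monicPencil_oplusZero
      (fun l => ContinuousLinearMap.isSelfAdjoint_iff_isSymmetric.1 (isSelfAdjoint_sumElim hΩ hΓ l))
      (fun l => ContinuousLinearMap.isSelfAdjoint_iff_isSymmetric.1 (hZ.1 l)) hZ.2

theorem polarDual_projX_eq_compressions [TopologicalSpace.SeparableSpace 𝒦]
    (hΩ : ∀ j, IsSelfAdjoint (Ω j)) (hΓ : ∀ k, IsSelfAdjoint (Γ k))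
    (hbdd : Bornology.IsBounded (shadow Ω Γ)) (K : ClosedSubmodule ℝ 𝒦) :
    polarDual (projX (spectrahedron 𝒦 (Sum.elim Ω Γ))) K = compressions Ω Γ K.toSubmodule := by
  refine Set.Subset.antisymm (fun A hA => ?_) fun A hA =>
    mem_polarDual_projX_of_compressions hΩ hΓ (fun K' Z hZ => hZ.2) hA
  rcases isEmpty_or_nonempty ι with hι | hι
  -- With no `x` variables boundedness carries no information, but only the `Γ` conditions remain
  -- and `π = 0` satisfies them. The space `G` and isometry `V` are borrowed from the other
  -- description.
  · rw [polarDual_projX_eq_compressions_oplusZero hΩ hΓ] at hA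
    obtain ⟨hsa, G, i1, i2, i3, hsep, V, -⟩ := hA
    refine ⟨hsa, G, i1, i2, i3, fun hfin => hsep ?_, V, 0, fun j => isEmptyElim j, fun k => ?_⟩
    · exact (WithLp.linearEquiv 2 ℝ (H × ℝ)).symm.finiteDimensional
    · ext x
      simp
  · exact mem_compressions_of_mem_polarDual hΩ hΓ hΩ hΓ
      (nonneg_of_isBounded_shadow hΩ hΓ hbdd) (fun n _ _ X h => h) hA

end Compressions

end FreeHilbert

end

theorem theorem1p4
    {H : Type u} [NormedAddCommGroup H] [InnerProductSpace ℝ H] [CompleteSpace H]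
    [TopologicalSpace.SeparableSpace H]
    {𝒦 : Type v} [NormedAddCommGroup 𝒦] [InnerProductSpace ℝ 𝒦] [CompleteSpace 𝒦]
    [TopologicalSpace.SeparableSpace 𝒦]
    {g h : ℕ} (Ω : Fin g → H →L[ℝ] H) (Γ : Fin h → H →L[ℝ] H)
    (hΩ : ∀ j, IsSelfAdjoint (Ω j)) (hΓ : ∀ k, IsSelfAdjoint (Γ k)) :
    (∀ K : ClosedSubmodule ℝ 𝒦,
      FreeHilbert.polarDual (FreeHilbert.projX (FreeHilbert.spectrahedron 𝒦 (Sum.elim Ω Γ))) K =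
        {A | (∀ j, IsSelfAdjoint (A j)) ∧
          Sum.elim A (fun _ : Fin h => 0) ∈ FreeHilbert.polarDual
            (FreeHilbert.spectrahedron 𝒦 (Sum.elim Ω Γ)) K} ∧
      FreeHilbert.polarDual (FreeHilbert.projX (FreeHilbert.spectrahedron 𝒦 (Sum.elim Ω Γ))) K =
        FreeHilbert.compressions (fun j => FreeHilbert.oplusZero (Ω j))
          (fun k => FreeHilbert.oplusZero (Γ k)) K.toSubmodule) ∧
    (Bornology.IsBounded (FreeHilbert.shadow Ω Γ) →
      ∀ K : ClosedSubmodule ℝ 𝒦,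
        FreeHilbert.polarDual (FreeHilbert.projX (FreeHilbert.spectrahedron 𝒦 (Sum.elim Ω Γ))) K =
          FreeHilbert.compressions Ω Γ K.toSubmodule) :=
  ⟨fun K => ⟨FreeHilbert.polarDual_projX _ K,
      FreeHilbert.polarDual_projX_eq_compressions_oplusZero hΩ hΓ K⟩,
    fun hbdd K => FreeHilbert.polarDual_projX_eq_compressions hΩ hΓ hbdd K⟩
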